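/- Let $K$ be an algebraically closed field of characteristic $0$, let $T=\mathbb G_m^r$ be a torus over $K$, let $V$ be a finite-dimensional algebraic representation of $T$, and let $\pi\colon V\to V/T=\operatorname{Spec}K[V]^T$ be the quotient map. A vector $v\in V$ is stable if its orbit is Zariski closed and $v$ is not in the closure of any other orbit; $V$ is stable if it contains a stable vector; $V^{sss}$ is the set of non-stable vectors. A stable representation $V$ is - pure if every irreducible component of $V^{sss}$ has codimension one in $V$; - npure if it is pure and every irreducible component of $V^{sss}$ maps to a divisor (a prime divisor) under $\pi$; - cnpure if it is npure and the image of every irreducible component of $V^{sss}$ is a principal divisor; - nice if every irreducible component of $V^{sss}$ of codimension one maps to a divisor under $\pi$ (so npure representations are nice). $V$ is cofree if $K[V]$ is a free $K[V]^T$-module. A variety over $K$ has finite quotient singularities if its completed local ring at every closed point is isomorphic to $K[[y_1,\dots,y_n]]^\Gamma$ for some $n$ and some finite group $\Gamma$ of $K$-algebra automorphisms of $K[[y_1,\dots,y_n]]$. An effective Weil divisor $D$ is Cartier if its ideal sheaf $\mathcal O(-D)$ is locally generated by one element, and $\mathbb Q$-Cartier if some positive multiple of it is Cartier; a variety is $\mathbb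 Q$-factorial if it is normal and every Weil divisor on it is $\mathbb Q$-Cartier. Then: 1. If $V$ is npure and $V/T$ is singular, then $V/T$ does not have finite quotient singularities. 2. If $V$ is npure and $V/T$ has finite quotient singularities, then $V$ is cnpure and cofree. 3. If $V$ is npure and $V/T$ is $\mathbb Q$-factorial, then $V$ is cnpure and cofree. 4. If $V$ is stable and nice (in particular, if $V$ is npure) and $Z$ is an irreducible component of $V^{sss}$ of codimension one, then $\pi(Z)$ is a prime divisor and $[\pi(Z)]$ is $\mathbb Q$-Cartier if and only if it is Cartier. -/

import Mathlib

open scoped Topology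

namespace TorusQuotient

noncomputable section

/-! ### Divisors on a normal affine variety, given by its coordinate ring -/

section Divisors

variable (A : Type*) [CommRing A]

/-- A prime divisor on `Spec A`: a prime ideal of height one. -/
def PrimeDivisor : Type _ := {P : Ideal A // P.IsPrime ∧ P.height = 1}

/-- An effective Weil divisor on `Spec A`: a finite sum of prime divisors with coefficients in `ℕ`. -/
abbrev EffectiveDivisor : Type _ := PrimeDivisor A →₀ ℕ

variable {A}

/-- The symbolic power `P⁽ⁿ⁾ = PⁿA_P ∩ A`. If `A` is a normal Noetherian domain and `P` has height
one, this is the ideal of all functions of order at least `n` along the prime divisor `P`. -/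
def symbolicPower (P : Ideal A) [P.IsPrime] (n : ℕ) : Ideal A :=
  ((P ^ n).map (algebraMap A (Localization.AtPrime P))).comap
    (algebraMap A (Localization.AtPrime P))

/-- The ideal of global sections of `𝒪(-D)`: the functions whose order of vanishing along `P` is at
least the multiplicity of `P` in `D`, for every prime divisor `P`. -/
def EffectiveDivisor.ideal (D : EffectiveDivisor A) : Ideal A :=
  ⨅ P : PrimeDivisor A, haveI := P.2.1; symbolicPower P.1 (D P)

/-- `D` is a principal divisor: `𝒪(-D)` is generated by one function. -/
def EffectiveDivisor.IsPrincipal (D : EffectiveDivisor A) : Prop :=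
  Submodule.IsPrincipal (EffectiveDivisor.ideal D)

/-- `D` is Cartier, that is, locally principal: at every point of `Spec A` the stalk of `𝒪(-D)` is
generated by one element. -/
def EffectiveDivisor.IsCartier (D : EffectiveDivisor A) : Prop :=
  ∀ (p : Ideal A) [p.IsPrime],
    Submodule.IsPrincipal
      ((EffectiveDivisor.ideal D).map (algebraMap A (Localization.AtPrime p)))

/-- `D` is `ℚ`-Cartier: some positive multiple of `D` is Cartier. -/
def EffectiveDivisor.IsQCartier (D : EffectiveDivisor A) : Prop :=
  ∃ n : ℕ, 0 < n ∧ EffectiveDivisor.IsCartier (n • D)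

variable (A)

/-- `Spec A` (for `A` a Noetherian domain) is `ℚ`-factorial: it is normal and every effective Weil
divisor is `ℚ`-Cartier (hence so is every Weil divisor, being a difference of effective ones). -/
def IsQFactorial : Prop :=
  IsIntegrallyClosed A ∧ ∀ D : EffectiveDivisor A, EffectiveDivisor.IsQCartier D

end Divisors

/-- The affine variety with coordinate ring `A` over the algebraically closed field `K` has finite
quotient singularities: the completed local ring at every closed point is isomorphic to the ring of
invariants of a finite group of automorphisms of a formal power series ring `K⟦y₁, …, yₙ⟧`. (The
completion of `A` at a maximal ideal is the completion of the local ring there.) -/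
def HasFiniteQuotientSingularities (K A : Type*) [Field K] [CommRing A] [Algebra K A] : Prop :=
  ∀ m : Ideal A, m.IsMaximal →
    ∃ (n : ℕ) (Γ : Subgroup (MvPowerSeries (Fin n) K ≃ₐ[K] MvPowerSeries (Fin n) K)),
      Finite Γ ∧
      Nonempty (AdicCompletion m A ≃ₐ[K] FixedPoints.subalgebra K (MvPowerSeries (Fin n) K) Γ)

/-! ### A finite-dimensional vector space as an affine variety -/

section AffineSpace

variable (K V : Type*) [Field K] [AddCommGroup V] [Module K V]

/-- The coordinate ring `K[V]`: the algebra of functions on `V` generated by the linear forms. -/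
def coordRing : Subalgebra K (V → K) :=
  Algebra.adjoin K (Set.range fun (φ : Module.Dual K V) (v : V) => φ v)

/-- The Zariski topology on `V`: generated by the sets `{f ≠ 0}` with `f ∈ K[V]`. -/
@[reducible] def zariski : TopologicalSpace V :=
  TopologicalSpace.generateFrom {U | ∃ f ∈ coordRing K V, U = {v | f v ≠ 0}}

/-- The ideal of all polynomial functions vanishing on `Z`. -/
def vanishingIdeal (Z : Set V) : Ideal (coordRing K V) where
  carrier := {f | ∀ z ∈ Z, f.1 z = 0}
  zero_mem' := fun _ _ => rfl
  add_mem' := fun {f g} hf hg z hz => by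
    change f.1 z + g.1 z = 0
    rw [hf z hz, hg z hz, add_zero]
  smul_mem' := fun c f hf z hz => by
    change c.1 z * f.1 z = 0
    rw [hf z hz, mul_zero]

/-- `Z` is an irreducible component of the subset `S` of `V`: a maximal irreducible subset. -/
def IsComponent (S Z : Set V) : Prop :=
  Maximal (fun Y : Set V => @IsIrreducible V (zariski K V) Y ∧ Y ⊆ S) Z

/-- The irreducible closed subset `Z` of `V` has codimension one. -/
def IsDivisorial (Z : Set V) : Prop :=
  (vanishingIdeal K V Z).height = 1

end AffineSpace

/-! ### Representations of tori -/

/-- The group of `K`-points of the algebraic torus `𝔾_m ^ r`. -/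
abbrev Torus (K : Type*) [Field K] (r : ℕ) : Type _ := Fin r → Kˣ

/-- The regular functions on `𝔾_m ^ r`: the Laurent polynomials in the coordinates. -/
def torusCoordRing (K : Type*) [Field K] (r : ℕ) : Submodule K (Torus K r → K) :=
  Submodule.span K
    (Set.range fun (a : Fin r → ℤ) (t : Torus K r) => ((∏ i, t i ^ a i : Kˣ) : K))

section Representations

variable {K V : Type*} [Field K] [AddCommGroup V] [Module K V] {r : ℕ}
  (ρ : Representation K (Torus K r) V)

/-- `ρ` is a representation of the algebraic group `𝔾_m ^ r`: its matrix coefficients are regular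
functions. -/
def IsAlgebraic : Prop :=
  ∀ (v : V) (φ : Module.Dual K V), (fun t => φ (ρ t v)) ∈ torusCoordRing K r

/-- The orbit of `v`. -/
def orbit (v : V) : Set V := Set.range fun t => ρ t v

/-- `v` is stable: its orbit is closed and `v` is not in the closure of any other orbit. -/
def IsStableVector (v : V) : Prop :=
  IsClosed[zariski K V] (orbit ρ v) ∧
    ∀ w, v ∈ closure[zariski K V] (orbit ρ w) → orbit ρ w = orbit ρ v

/-- `V` is a stable representation: it contains a stable vector. -/
def IsStable : Prop := ∃ v, IsStableVector ρ v

/-- The strictly semi-stable locus: the complement of the set of stable vectors. -/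
def sssLocus : Set V := {v | ¬ IsStableVector ρ v}

/-- The invariant ring `K[V]ᵀ`, the coordinate ring of the quotient `V/T`. -/
def invariants : Subalgebra K (coordRing K V) where
  carrier := {f | ∀ t v, f.1 (ρ t v) = f.1 v}
  mul_mem' := fun {f g} hf hg t v => by
    change f.1 (ρ t v) * g.1 (ρ t v) = f.1 v * g.1 v
    rw [hf t v, hg t v]
  add_mem' := fun {f g} hf hg t v => by
    change f.1 (ρ t v) + g.1 (ρ t v) = f.1 v + g.1 v
    rw [hf t v, hg t v]
  algebraMap_mem' := fun _ _ _ => rfl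

/-- The ideal in `K[V]ᵀ` of the image of `Z` under the quotient map `V → V/T`: the invariant
functions vanishing on `Z`. -/
def imageIdeal (Z : Set V) : Ideal (invariants ρ) :=
  (vanishingIdeal K V Z).comap (algebraMap (invariants ρ) (coordRing K V))

/-- The image of `Z` (taken with its reduced structure) under the quotient map is a prime divisor on
`V/T`. -/
def MapsToDivisor (Z : Set V) : Prop :=
  (imageIdeal ρ Z).IsPrime ∧ Ideal.height (R := invariants ρ) (imageIdeal ρ Z) = 1

variable {ρ} in
/-- The Weil divisor `[π(Z)]` on `V/T`. -/
def imageDivisor {Z : Set V} (h : MapsToDivisor ρ Z) : EffectiveDivisor (invariants ρ) :=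
  Finsupp.single (⟨imageIdeal ρ Z, h⟩ : PrimeDivisor (invariants ρ)) 1

/-- `V` is nice: every component of `V^sss` of codimension one maps to a divisor. (For a stable
representation, invariant divisors that meet the stable locus always map to divisors.) -/
def IsNice : Prop :=
  ∀ Z, IsComponent K V (sssLocus ρ) Z → IsDivisorial K V Z → MapsToDivisor ρ Z

/-- `V` is pure: it is stable and `V^sss` has pure codimension one. -/
def IsPure : Prop :=
  IsStable ρ ∧ ∀ Z, IsComponent K V (sssLocus ρ) Z → IsDivisorial K V Z

/-- `V` is npure: it is pure and every component of `V^sss` maps to a divisor. -/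
def IsNPure : Prop :=
  IsPure ρ ∧ ∀ Z, IsComponent K V (sssLocus ρ) Z → MapsToDivisor ρ Z

/-- `V` is cnpure: it is npure and every component of `V^sss` maps to a principal divisor. -/
def IsCNPure : Prop :=
  IsNPure ρ ∧ ∀ Z, IsComponent K V (sssLocus ρ) Z →
    ∃ h : MapsToDivisor ρ Z, EffectiveDivisor.IsPrincipal (imageDivisor h)

/-- `V` is cofree: `K[V]` is a free `K[V]ᵀ`-module. -/
def IsCofree : Prop := Module.Free (invariants ρ) (coordRing K V)

end Representations

end

end TorusQuotient

/-! In a basis of weight vectors `K[V]` is a polynomial ring, and `K[V]ᵀ` is spanned by the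
monomials with exponent in the monoid `M` of nonnegative integer relations among the weights. `M` is
finitely generated, closed under subtraction inside `ℕⁿ`, and saturated. The problem becomes
combinatorics of `M`.

Stability depends only on the support: `v` is stable iff every set of coordinates containing its
support is the support of an element of `M` (`isStableVector_iff`). So `V^sss` is a union of
coordinate subspaces. Its components of codimension one are the hyperplanes `x_k = 0` with `k` tied:
the face `m k = 0` of `M` lies in a second coordinate hyperplane. The image of such a hyperplane is
cut out by the ideal `p_k` of invariants all of whose monomials involve `x_k`. If `p_k` has height
one, any two monomials in it divide powers of each other up to factors outside `p_k`; on exponents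
this is `IsArchimedeanAt`.

Each geometric hypothesis yields one element of `p_k` that divides, near the origin, a power of
every monomial in `p_k`. For a `ℚ`-Cartier divisor it is a local equation of a multiple. For a
finite quotient singularity the completed local ring is `Bᴳ` with `B` a power series ring, hence
factorial, and the element is the norm of a prime of `B`
(`exists_mem_forall_dvd_pow_of_finite_group`). Divisors of monomials in a power series ring are
monomials up to units, so there is `u ∈ M` with `u k ≠ 0` such that every `m ∈ M` with `m k ≠ 0` has
a multiple above `u`.

The coordinates in the support of `u` vanish on the same face as `k`, and the archimedean property
makes them proportional on `M`. Dividing `u` by the gcd of its entries gives the least element of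
`M` with positive `k`-th coordinate (`exists_isLeastAt`), so `p_k` is generated by one monomial.
This already gives the Cartier statement.

If `V` is npure, the tied coordinates form a stable support, and subtracting least elements produces
least elements for the untied coordinates too. Then `M` is free on its least elements, so the
invariant ring is a polynomial ring, hence regular. Every exponent is uniquely an element of `M`
plus a reduced exponent, so `K[V]` is free over the invariants on the reduced monomials. -/

namespace TorusQuotient

noncomputable section

/-! ### Factoriality of power series rings via Weierstrass preparation -/

section PowerSeriesUFD

variable (K : Type*) [Field K]

-- The power series ring is the completion of the polynomial ring at the ideal of the variables.
-- There the kernel of reduction modulo that ideal is its extension, because the ideal is finitely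
-- generated.
open MvPowerSeries in
theorem maximalIdeal_mvPowerSeries_eq_span {σ : Type*} [Finite σ] :
    IsLocalRing.maximalIdeal (MvPowerSeries σ K) = Ideal.span (Set.range X) := by
  refine le_antisymm (fun f hf => ?_) (Ideal.span_le.2 ?_)
  · have hf0 : constantCoeff f = 0 := by
      by_contra h
      exact hf (isUnit_iff_constantCoeff.2 (isUnit_iff_ne_zero.2 h))
    have hmem : toAdicCompletion σ K f ∈
        (MvPolynomial.idealOfVars σ K).map (algebraMap (MvPolynomial σ K)
          (AdicCompletion (MvPolynomial.idealOfVars σ K) (MvPolynomial σ K))) := by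
      rw [← AdicCompletion.ker_evalOneₐ_eq_map _ (MvPolynomial.idealOfVars_fg σ K)]
      change AdicCompletion.evalOneₐ _ (toAdicCompletion σ K f) = 0
      have ht : truncTotal 1 f = 0 := by
        ext e
        by_cases he : e.degree < 1
        · have : e = 0 := (Finsupp.degree_eq_zero_iff e).1 (by omega)
          subst this
          rw [coeff_truncTotal _ he]
          simpa using hf0
        · rw [coeff_truncTotal_eq_zero _ (by omega)]
          simp
      rw [toAdicCompletion, AdicCompletion.evalOneₐ_liftAlgHom]
      · simp [ht]
      · exact fun h ↦ AlgHom.ext fun _ ↦ by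
          simpa [Ideal.Quotient.mk_eq_mk_iff_sub_mem] using
            truncTotal_sub_truncTotal_mem_pow_idealOfVars h (le_refl _) _
    have heq : Ideal.map (toAdicCompletionAlgEquiv σ K).toRingEquiv (Ideal.span (Set.range X)) =
        (MvPolynomial.idealOfVars σ K).map (algebraMap ..) := by
      simp_rw [Ideal.map_span, ← Set.range_comp]
      congr 2; ext1
      simp [AdicCompletion.algebraMap_apply, ← MvPolynomial.coe_X, toAdicCompletion_coe]
    rw [← heq] at hmem
    obtain ⟨g, hg, hgf⟩ := (Ideal.mem_map_iff_of_surjective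
      (toAdicCompletionAlgEquiv σ K).toRingEquiv (RingEquiv.surjective _)).1 hmem
    have : g = f := (toAdicCompletionAlgEquiv σ K).injective (by simpa using hgf)
    exact this ▸ hg
  · rintro _ ⟨i, rfl⟩
    simp [isUnit_iff_constantCoeff]

open MvPowerSeries in
/-- A power series ring in finitely many variables over a field is adically complete. -/
theorem isAdicComplete_maximalIdeal_mvPowerSeries {σ : Type*} [Finite σ] :
    IsAdicComplete (IsLocalRing.maximalIdeal (MvPowerSeries σ K)) (MvPowerSeries σ K) := by
  rw [maximalIdeal_mvPowerSeries_eq_span]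
  infer_instance

variable {K}

open PowerSeries in
/-- A monic factor of a distinguished polynomial over a local domain is distinguished. -/
theorem isDistinguishedAt_of_monic_of_dvd {R : Type*} [CommRing R] [IsDomain R] [IsLocalRing R]
    {P Q : Polynomial R} (hP : P.IsDistinguishedAt (IsLocalRing.maximalIdeal R)) (hQ : Q.Monic)
    (h : Q ∣ P) : Q.IsDistinguishedAt (IsLocalRing.maximalIdeal R) := by
  refine ⟨⟨fun {i} hi => ?_⟩, hQ⟩
  -- Modulo the maximal ideal `P` becomes a power of `X`, so the monic factor `Q` does too.
  have hdvd : Q.map (IsLocalRing.residue R) ∣ Polynomial.X ^ P.natDegree := by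
    have := Polynomial.map_dvd (IsLocalRing.residue R) h
    rwa [show P.map (IsLocalRing.residue R) = Polynomial.X ^ P.natDegree from hP.map_eq_X_pow] at this
  obtain ⟨e, -, he⟩ := (dvd_prime_pow Polynomial.prime_X _).1 hdvd
  have heq : Q.map (IsLocalRing.residue R) = Polynomial.X ^ e :=
    Polynomial.eq_of_monic_of_associated (hQ.map _) (Polynomial.monic_X_pow e) he
  have hdeg : Q.natDegree = e := by
    rw [← hQ.natDegree_map (IsLocalRing.residue R), heq, Polynomial.natDegree_X_pow]
  have hc := congrArg (fun p => p.coeff i) heq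
  simp only [Polynomial.coeff_map, Polynomial.coeff_X_pow] at hc
  rw [if_neg (by omega)] at hc
  exact Ideal.Quotient.eq_zero_iff_mem.1 hc

/-- Over a complete local factorial domain, a prime ideal of the power series ring that contains
a series with nonzero reduction contains a prime element. -/
theorem exists_prime_mem_of_map_residue_ne_zero {R : Type*} [CommRing R] [IsDomain R]
    [IsLocalRing R] [UniqueFactorizationMonoid R] [IsAdicComplete (IsLocalRing.maximalIdeal R) R]
    (q : Ideal (PowerSeries R)) [hq : q.IsPrime] {f : PowerSeries R} (hf : f ∈ q)
    (hf0 : f.map (IsLocalRing.residue R) ≠ 0) : ∃ x ∈ q, Prime x := by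
  obtain ⟨P, h, H⟩ := PowerSeries.exists_isWeierstrassFactorization hf0
  have hPq : (P : PowerSeries R) ∈ q := by
    refine (hq.mem_or_mem (H.eq_mul ▸ hf)).resolve_right fun hh => ?_
    exact hq.ne_top (Ideal.eq_top_of_isUnit_mem _ hh H.isUnit)
  have hP0 : P ≠ 0 := H.isDistinguishedAt.monic.ne_zero
  let q' : Ideal (Polynomial R) := q.comap (Polynomial.coeToPowerSeries.ringHom (R := R))
  have hq' : q'.IsPrime := Ideal.comap_isPrime _ _
  have hPq' : P ∈ q' := hPq
  obtain ⟨s, hs, hsP⟩ := UniqueFactorizationMonoid.exists_prime_factors P hP0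
  have hsq : s.prod ∈ q' := by
    obtain ⟨u, hu⟩ := hsP.symm
    rw [← hu]; exact Ideal.mul_mem_right _ _ hPq'
  obtain ⟨Q, hQs, hQq⟩ := (hq'.multiset_prod_mem_iff_exists_mem s).1 hsq
  have hQP : Q ∣ P := (Multiset.dvd_prod hQs).trans hsP.dvd
  obtain ⟨Q', hQQ'⟩ := hQP
  have hlead : Q.leadingCoeff * Q'.leadingCoeff = 1 := by
    rw [← Polynomial.leadingCoeff_mul, ← hQQ']; exact H.isDistinguishedAt.monic
  -- A factor of a monic polynomial has unit leading coefficient, so it can be made monic without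
  -- changing its divisibility properties.
  set Q₁ := Q * Polynomial.C Q'.leadingCoeff with hQ₁
  have hmonic : Q₁.Monic := by
    rw [Polynomial.Monic, hQ₁, Polynomial.leadingCoeff_mul, Polynomial.leadingCoeff_C, hlead]
  have hass : Associated Q Q₁ := by
    refine associated_mul_unit_right _ _ (Polynomial.isUnit_C.2 ?_)
    exact IsUnit.of_mul_eq_one _ (by rw [mul_comm]; exact hlead)
  have hprime : Prime Q₁ := (hass.prime_iff).1 (hs Q hQs)
  have hdist : Q₁.IsDistinguishedAt (IsLocalRing.maximalIdeal R) :=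
    isDistinguishedAt_of_monic_of_dvd H.isDistinguishedAt hmonic
      (hass.symm.dvd.trans ⟨Q', hQQ'⟩)
  refine ⟨(Q₁ : PowerSeries R), ?_, ?_⟩
  · have : Q₁ ∈ q' := Ideal.mul_mem_right _ _ hQq
    exact this
  · have hne : (Q₁ : PowerSeries R) ≠ 0 := by
      simpa using hprime.ne_zero
    -- Weierstrass division identifies `R⟦X⟧/(Q₁)` with `R[X]/(Q₁)` for distinguished `Q₁`, so
    -- primality carries over from polynomials to series.
    rw [← Ideal.span_singleton_prime hne, ← Ideal.Quotient.isDomain_iff_prime]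
    have hd : IsDomain (Polynomial R ⧸ Ideal.span {Q₁}) :=
      (Ideal.Quotient.isDomain_iff_prime _).2 ((Ideal.span_singleton_prime hprime.ne_zero).2 hprime)
    exact (hdist.algEquivQuotient).symm.toMulEquiv.isDomain _

open MvPowerSeries

/-- Restriction of a power series to the first coordinate axis. -/
def restrictAxis (n : ℕ) : MvPowerSeries (Fin (n + 1)) K →+* PowerSeries K :=
  (PowerSeries.map constantCoeff).comp (finSuccEquiv K n).toRingEquiv.toRingHom

theorem coeff_restrictAxis {n : ℕ} (f : MvPowerSeries (Fin (n + 1)) K) (k : ℕ) :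
    PowerSeries.coeff k (restrictAxis n f) = coeff (Finsupp.single 0 k) f := by
  have : Finsupp.cons k 0 = (Finsupp.single 0 k : Fin (n + 1) →₀ ℕ) := by
    ext i; refine Fin.cases ?_ (fun i => ?_) i <;> simp
  rw [← this, ← coeff_coeff_finSuccEquiv]
  simp [restrictAxis]

theorem restrictAxis_X_zero {n : ℕ} : restrictAxis n (X 0 : MvPowerSeries (Fin (n + 1)) K) = .X := by
  simp [restrictAxis]

theorem restrictAxis_X_succ {n : ℕ} (i : Fin n) :
    restrictAxis n (X i.succ : MvPowerSeries (Fin (n + 1)) K) = 0 := by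
  simp [restrictAxis]

/-- The linear substitution `x₀ ↦ c₀x₀`, `xᵢ ↦ xᵢ + cᵢx₀`. -/
def shear {n : ℕ} (c : Fin (n + 1) → K) : Fin (n + 1) → MvPowerSeries (Fin (n + 1)) K :=
  Fin.cons (C (c 0) * X 0) fun i => X i.succ + C (c i.succ) * X 0

theorem shear_zero {n : ℕ} (c : Fin (n + 1) → K) : shear c 0 = C (c 0) * X 0 := rfl

theorem shear_succ {n : ℕ} (c : Fin (n + 1) → K) (i : Fin n) :
    shear c i.succ = X i.succ + C (c i.succ) * X 0 := rfl

theorem hasSubst_shear {n : ℕ} (c : Fin (n + 1) → K) : HasSubst (shear c) :=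
  hasSubst_of_constantCoeff_zero fun i => by
    refine Fin.cases ?_ (fun i => ?_) i
    · simp [shear_zero]
    · simp [shear_succ]

theorem restrictAxis_shear {n : ℕ} (c : Fin (n + 1) → K) (i : Fin (n + 1)) :
    restrictAxis n (shear c i) = PowerSeries.C (c i) * .X := by
  have hC (a : K) : restrictAxis n (C a) = PowerSeries.C a := by simp [restrictAxis]
  refine Fin.cases ?_ (fun i => ?_) i
  · simp [shear_zero, restrictAxis_X_zero, hC]
  · simp [shear_succ, restrictAxis_X_zero, restrictAxis_X_succ, hC]

/-- The two hypotheses say that the parameters `d` are those of the inverse linear substitution. -/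
theorem substAlgHom_shear_comp {n : ℕ} {c d : Fin (n + 1) → K} (h0 : c 0 * d 0 = 1)
    (h : ∀ i : Fin n, d i.succ + c i.succ * d 0 = 0) :
    (substAlgHom (hasSubst_shear d)).comp (substAlgHom (hasSubst_shear c)) =
      AlgHom.id K (MvPowerSeries (Fin (n + 1)) K) := by
  have hC (a : K) : substAlgHom (R := K) (hasSubst_shear d) (C a) = C a :=
    (substAlgHom (R := K) (hasSubst_shear d)).commutes a
  ext1 f
  rw [AlgHom.comp_apply, substAlgHom_comp_substAlgHom_apply]
  have hX : (fun i => substAlgHom (R := K) (hasSubst_shear d) (shear c i)) = X := by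
    funext i
    refine Fin.cases ?_ (fun i => ?_) i
    · rw [shear_zero, map_mul, hC, substAlgHom_X, shear_zero, ← mul_assoc, ← map_mul, h0]; simp
    · rw [shear_succ, map_add, map_mul, hC, substAlgHom_X, substAlgHom_X, shear_zero, shear_succ,
        add_assoc, ← mul_assoc, ← map_mul, ← add_mul, ← map_add, h]; simp
  have hs := congrFun (subst_self (σ := Fin (n + 1)) (R := K)) f
  simp only [coe_substAlgHom] at hX ⊢
  rw [hX]
  simpa using hs

/-- On the first axis the shear becomes `xᵢ ↦ cᵢx₀`, so only the homogeneous part of degree `k`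
contributes to the coefficient of `x₀ᵏ`, through its value at `c`. -/
theorem coeff_axis_subst_shear {n : ℕ} (c : Fin (n + 1) → K)
    (f : MvPowerSeries (Fin (n + 1)) K) (k : ℕ) :
    coeff (Finsupp.single 0 k) (substAlgHom (R := K) (hasSubst_shear c) f) =
      MvPolynomial.eval c (∑ m ∈ Finset.finsuppAntidiag Finset.univ k,
        MvPolynomial.monomial m (coeff m f)) := by
  have hm (m : Fin (n + 1) →₀ ℕ) : coeff (Finsupp.single 0 k) (m.prod fun i e => shear c i ^ e) =
      if m.degree = k then m.prod fun i e => c i ^ e else 0 := by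
    rw [← coeff_restrictAxis, Finsupp.prod, map_prod]
    simp only [map_pow, restrictAxis_shear, mul_pow, Finset.prod_mul_distrib]
    rw [Finset.prod_pow_eq_pow_sum, ← Finsupp.degree_apply]
    simp only [← map_pow, ← map_prod]
    rw [PowerSeries.coeff_C_mul, PowerSeries.coeff_X_pow]
    simp [Finsupp.prod, eq_comm]
  rw [substAlgHom_apply, coeff_subst (hasSubst_shear c)]
  simp only [hm, smul_eq_mul]
  rw [finsum_eq_sum_of_support_subset (s := Finset.finsuppAntidiag Finset.univ k), map_sum]
  · refine Finset.sum_congr rfl fun m hmem => ?_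
    have : m.degree = k := by
      rw [Finset.mem_finsuppAntidiag] at hmem
      rw [Finsupp.degree_eq_sum]; exact hmem.1
    rw [if_pos this, MvPolynomial.eval_monomial]
  · intro m hmem
    simp only [Function.mem_support, ne_eq, mul_eq_zero, not_or, ite_eq_right_iff, not_forall] at hmem
    obtain ⟨-, h, -⟩ := hmem
    simp only [Finset.mem_coe, Finset.mem_finsuppAntidiag]
    exact ⟨by rw [← h, Finsupp.degree_eq_sum], Finset.subset_univ _⟩

/-- After a linear change of variables, a nonzero power series over an infinite field does not
vanish on the first coordinate axis. -/
theorem exists_algEquiv_restrictAxis_ne_zero [Infinite K] {n : ℕ}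
    {f : MvPowerSeries (Fin (n + 1)) K} (hf : f ≠ 0) :
    ∃ e : MvPowerSeries (Fin (n + 1)) K ≃ₐ[K] MvPowerSeries (Fin (n + 1)) K,
      restrictAxis n (e f) ≠ 0 := by
  obtain ⟨m₀, hm₀⟩ : ∃ m, coeff m f ≠ 0 := by
    by_contra! h
    exact hf (MvPowerSeries.ext h)
  set P : MvPolynomial (Fin (n + 1)) K := ∑ m ∈ Finset.finsuppAntidiag Finset.univ m₀.degree,
        MvPolynomial.monomial m (coeff m f) with hP
  have hP0 : P ≠ 0 := by
    intro h
    have := congrArg (MvPolynomial.coeff m₀) h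
    rw [hP, MvPolynomial.coeff_sum] at this
    simp only [MvPolynomial.coeff_monomial, MvPolynomial.coeff_zero] at this
    rw [Finset.sum_ite_eq' , if_pos] at this
    · exact hm₀ this
    · simp [Finset.mem_finsuppAntidiag, Finsupp.degree_eq_sum]
  -- The extra factor `X 0` forces `c 0 ≠ 0`, which makes the shear invertible.
  obtain ⟨c, hc⟩ : ∃ c, MvPolynomial.eval c (MvPolynomial.X 0 * P) ≠ 0 := by
    by_contra! h
    exact mul_ne_zero (MvPolynomial.X_ne_zero 0) hP0 (MvPolynomial.funext (by simpa using h))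
  rw [map_mul, MvPolynomial.eval_X] at hc
  have hc0 : c 0 ≠ 0 := left_ne_zero_of_mul hc
  let d : Fin (n + 1) → K := Fin.cons (c 0)⁻¹ fun i => - (c i.succ * (c 0)⁻¹)
  have hd0 : d 0 = (c 0)⁻¹ := rfl
  have hds (i : Fin n) : d i.succ = - (c i.succ * (c 0)⁻¹) := rfl
  refine ⟨AlgEquiv.ofAlgHom (substAlgHom (hasSubst_shear c)) (substAlgHom (hasSubst_shear d))
    (substAlgHom_shear_comp ?_ ?_) (substAlgHom_shear_comp ?_ ?_), fun h => ?_⟩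
  · rw [hd0, inv_mul_cancel₀ hc0]
  · intro i; rw [hds, neg_mul, mul_assoc, inv_mul_cancel₀ hc0]; ring
  · rw [hd0, mul_inv_cancel₀ hc0]
  · intro i; rw [hds, hd0]; ring
  · have := congrArg (PowerSeries.coeff m₀.degree) h
    rw [coeff_restrictAxis] at this
    erw [coeff_axis_subst_shear] at this
    exact right_ne_zero_of_mul hc (by rw [hP, this, map_zero])

/-- A power series ring in finitely many variables over an infinite field is factorial. -/
theorem uniqueFactorizationMonoid_mvPowerSeries [Infinite K] (n : ℕ) :
    UniqueFactorizationMonoid (MvPowerSeries (Fin n) K) := by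
  induction n with
  | zero => exact (isEmptyEquiv (Fin 0) K).toMulEquiv.symm.uniqueFactorizationMonoid inferInstance
  | succ n ih =>
    have := isAdicComplete_maximalIdeal_mvPowerSeries K (σ := Fin n)
    have : IsDomain (MvPowerSeries (Fin n) K) := NoZeroDivisors.to_isDomain _
    have : IsDomain (MvPowerSeries (Fin (n + 1)) K) := NoZeroDivisors.to_isDomain _
    -- Kaplansky's criterion: it is enough to find a prime element in every nonzero prime ideal.
    refine UniqueFactorizationMonoid.iff_exists_prime_mem_of_isPrime.2 fun q hq0 hq => ?_
    obtain ⟨f, hfq, hf0⟩ := Submodule.exists_mem_ne_zero_of_ne_bot hq0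
    obtain ⟨e, he⟩ := exists_algEquiv_restrictAxis_ne_zero hf0
    let E : MvPowerSeries (Fin (n + 1)) K ≃+* PowerSeries (MvPowerSeries (Fin n) K) :=
      (e.trans (finSuccEquiv K n)).toRingEquiv
    -- A coefficient with zero residue has zero constant term; if all had, the series would vanish
    -- on the first axis.
    have hres : (E f).map (IsLocalRing.residue (MvPowerSeries (Fin n) K)) ≠ 0 := by
      intro h
      apply he
      ext k
      have hk := congrArg (PowerSeries.coeff k) h
      rw [PowerSeries.coeff_map, map_zero, IsLocalRing.residue_eq_zero_iff,
        IsLocalRing.mem_maximalIdeal, mem_nonunits_iff, isUnit_iff_constantCoeff,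
        isUnit_iff_ne_zero, not_not] at hk
      change PowerSeries.coeff k (PowerSeries.map constantCoeff (E f)) = _
      rw [PowerSeries.coeff_map, hk, map_zero]
    have hEf : E f ∈ q.comap (E.symm : _ →+* _) := by
      simpa [Ideal.mem_comap] using hfq
    obtain ⟨x, hxq, hx⟩ := exists_prime_mem_of_map_residue_ne_zero
      (q.comap (E.symm : PowerSeries (MvPowerSeries (Fin n) K) →+* _)) hEf hres
    exact ⟨E.symm x, hxq, (MulEquiv.prime_iff E.symm.toMulEquiv).2 hx⟩

end PowerSeriesUFD

/-! ### Combinatorics of submonoids of `ℕⁿ`: tied coordinates, least elements, freeness -/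

section Monoids

variable {ι : Type*} (M : AddSubmonoid (ι →₀ ℕ))

/-- The face of `M` where the `k`-th coordinate vanishes lies in another coordinate hyperplane. -/
def IsTied (k : ι) : Prop := ∃ i ≠ k, ∀ m ∈ M, m k = 0 → m i = 0

/-- Modulo the face of `M` where the `k`-th coordinate vanishes, the order of `M` is archimedean. -/
def IsArchimedeanAt (k : ι) : Prop :=
  ∀ m ∈ M, ∀ m' ∈ M, m' k ≠ 0 → ∃ N : ℕ, ∃ f ∈ M, f k = 0 ∧ m ≤ f + N • m'

/-- Every set of coordinates containing `S` is the support of an element of `M`. -/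
def IsStableSupport (S : Set ι) : Prop :=
  ∀ S' : Set ι, S ⊆ S' → ∃ m ∈ M, ∀ i, m i ≠ 0 ↔ i ∈ S'

/-- `c` is the smallest element of `M` whose `k`-th coordinate is positive. -/
def IsLeastAt (k : ι) (c : ι →₀ ℕ) : Prop := c ∈ M ∧ c k ≠ 0 ∧ ∀ m ∈ M, m k ≠ 0 → c ≤ m

variable {M}

theorem IsStableSupport.mono {S S' : Set ι} (h : IsStableSupport M S) (hS : S ⊆ S') :
    IsStableSupport M S' := fun T hT => h T (hS.trans hT)

theorem not_isStableSupport_of_isTied {k : ι} (h : IsTied M k) : ¬ IsStableSupport M {k}ᶜ := by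
  obtain ⟨i, hik, hi⟩ := h
  intro hs
  obtain ⟨m, hm, hms⟩ := hs _ subset_rfl
  have h1 : m k = 0 := by by_contra h; exact (hms k).1 h rfl
  exact (hms i).2 hik (hi m hm h1)

/-- The only supersets of `{k}ᶜ` are itself and everything. If `k` is not tied, each `i ≠ k` has a
witness in the face at `k` that is positive at `i`, and the sum of the witnesses has support `{k}ᶜ`.
-/
theorem isTied_of_not_isStableSupport [Finite ι] {k : ι} (huniv : IsStableSupport M Set.univ)
    (h : ¬ IsStableSupport M {k}ᶜ) : IsTied M k := by
  classical
  cases nonempty_fintype ι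
  by_contra hk
  simp only [IsTied, not_exists, not_and, not_forall] at hk
  refine h fun S' hS' => ?_
  by_cases hkS : k ∈ S'
  · have : S' = Set.univ := Set.eq_univ_of_forall fun i => by
      by_cases hi : i = k
      · exact hi ▸ hkS
      · exact hS' hi
    exact this ▸ huniv _ subset_rfl
  · have : S' = {k}ᶜ := subset_antisymm (fun i hi h => hkS (by rwa [Set.mem_singleton_iff.1 h] at hi)) hS'
    subst this
    choose! f hfM hfk hfi using hk
    refine ⟨∑ i ∈ Finset.univ.erase k, f i, M.sum_mem fun i hi => hfM i (Finset.ne_of_mem_erase hi),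
      fun i => ?_⟩
    rw [Finsupp.finsetSum_apply]
    simp only [ne_eq, Finset.sum_eq_zero_iff, not_forall, Set.mem_compl_iff, Set.mem_singleton_iff]
    constructor
    · rintro ⟨j, hj, hji⟩ rfl
      exact hji (hfk j (Finset.ne_of_mem_erase hj))
    · intro hi
      exact ⟨i, by simp [hi], hfi i hi⟩

/-- Two coordinates that vanish on the same archimedean face are proportional. -/
theorem mul_eq_mul_of_isArchimedeanAt (hfg : M.FG) (hsub : ∀ x ∈ M, ∀ y, x + y ∈ M → y ∈ M)
    {i j : ι} (hj : IsArchimedeanAt M j) (h : ∀ m ∈ M, m i = 0 ↔ m j = 0) {m m' : ι →₀ ℕ}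
    (hm : m ∈ M) (hm' : m' ∈ M) : m i * m' j = m' i * m j := by
  obtain ⟨S, hS⟩ := hfg
  have hSM : ∀ s ∈ S, s ∈ M := fun s hs => hS ▸ AddSubmonoid.subset_closure hs
  by_cases hne : (S.filter fun s => s j ≠ 0).Nonempty
  -- `m₀` minimizes the ratio of the `i`-th to the `j`-th coordinate among generators. The
  -- cross-multiplied inequality is additive, so it extends to all of `M`.
  · obtain ⟨m₀, hm₀, hmin⟩ := (S.filter fun s => s j ≠ 0).exists_min_image
      (fun s => (s i : ℚ) / s j) hne
    rw [Finset.mem_filter] at hm₀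
    have hm₀M := hSM _ hm₀.1
    have hm₀j := hm₀.2
    have hle : ∀ x ∈ M, m₀ i * x j ≤ x i * m₀ j := by
      intro x hx
      rw [← hS] at hx
      induction hx using AddSubmonoid.closure_induction with
      | mem s hs =>
        by_cases hsj : s j = 0
        · simp [hsj]
        · have := hmin s (by simp [hsj]; exact hs)
          rw [div_le_div_iff₀ (by positivity) (by positivity)] at this
          exact_mod_cast this
      | zero => simp
      | add x y _ _ hx hy => simp only [Finsupp.add_apply]; nlinarith
    have heq : ∀ x ∈ M, m₀ i * x j = x i * m₀ j := by
      intro x hx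
      refine (hle x hx).antisymm ?_
      -- The complement `d` of `x` in `f + N • m₀` also lies in `M`, and `f` vanishes at `i` and
      -- `j`. The inequality for `d` is therefore the reverse inequality for `x`.
      obtain ⟨N, f, hf, hfj, hxf⟩ := hj x hx m₀ hm₀M hm₀.2
      obtain ⟨d, hd⟩ := exists_add_of_le hxf
      have hdM : d ∈ M := hsub x hx d (hd ▸ M.add_mem hf (M.nsmul_mem hm₀M N))
      have hdle := hle d hdM
      have hi := DFunLike.congr_fun hd i
      have hj' := DFunLike.congr_fun hd j
      simp only [Finsupp.add_apply, Finsupp.smul_apply, smul_eq_mul, hfj, (h f hf).2 hfj,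
        zero_add] at hi hj'
      nlinarith
    have h1 := heq m hm
    have h2 := heq m' hm'
    have : m₀ j ≠ 0 := hm₀.2
    apply Nat.eq_of_mul_eq_mul_right (Nat.pos_of_ne_zero this)
    calc m i * m' j * m₀ j = (m i * m₀ j) * m' j := by ring
      _ = (m₀ i * m' j) * m j := by rw [← h1]; ring
      _ = m' i * m j * m₀ j := by rw [h2]; ring
  · have hz : ∀ x ∈ M, x j = 0 := by
      intro x hx
      rw [← hS] at hx
      induction hx using AddSubmonoid.closure_induction with
      | mem s hs =>
        by_contra hsj
        exact hne ⟨s, by simp [hsj]; exact hs⟩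
      | zero => simp
      | add x y _ _ hx hy => simp [hx, hy]
    simp [hz m hm, hz m' hm']

/-- The bound by `u` shows that each coordinate in its support vanishes only where `j` does, and the
archimedean property gives the converse. All these coordinates are then proportional to the `j`-th
one on `M`, so the primitive vector on the ray of `u`, which is in `M` by saturation, lies below
every `m` with `m j ≠ 0`. -/
theorem exists_isLeastAt [Finite ι] (hfg : M.FG) (hsub : ∀ x ∈ M, ∀ y, x + y ∈ M → y ∈ M)
    (hdiv : ∀ N : ℕ, N ≠ 0 → ∀ x, N • x ∈ M → x ∈ M) (huniv : IsStableSupport M Set.univ)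
    (harch : ∀ k, IsTied M k → IsArchimedeanAt M k) {j : ι} (hj : IsTied M j) {u : ι →₀ ℕ}
    (huM : u ∈ M) (huj : u j ≠ 0) (hu : ∀ m ∈ M, m j ≠ 0 → ∃ N : ℕ, u ≤ N • m) :
    ∃ c, IsLeastAt M j c ∧ ∀ k, c k ≠ 0 → IsTied M k := by
  classical
  cases nonempty_fintype ι
  have h1 : ∀ k, u k ≠ 0 → ∀ m ∈ M, m k = 0 → m j = 0 := by
    intro k hk m hm hmk
    by_contra hmj
    obtain ⟨N, hN⟩ := hu m hm hmj
    have := hN k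
    rw [Finsupp.smul_apply, hmk, smul_zero] at this
    omega
  have htied : ∀ k, u k ≠ 0 → IsTied M k := by
    intro k hk
    by_cases hkj : j = k
    · exact hkj ▸ hj
    · exact ⟨j, hkj, h1 k hk⟩
  obtain ⟨w, hw, hws⟩ := huniv _ subset_rfl
  have h2 : ∀ k, u k ≠ 0 → ∀ m ∈ M, m k = 0 ↔ m j = 0 := by
    refine fun k hk m hm => ⟨h1 k hk m hm, fun hmj => ?_⟩
    by_contra hmk
    -- The element `w` is positive everywhere, while `f` and `m` both vanish at `j`, so the bound
    -- fails there.
    obtain ⟨N, f, hf, hfk, hle⟩ := harch k (htied k hk) w hw m hm hmk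
    have := hle j
    rw [Finsupp.add_apply, Finsupp.smul_apply, hmj, h1 k hk f hf hfk, smul_zero] at this
    exact (hws j).2 trivial (by omega)
  have h3 : ∀ k, u k ≠ 0 → ∀ m ∈ M, m k * u j = u k * m j := fun k hk m hm =>
    mul_eq_mul_of_isArchimedeanAt hfg hsub (harch j hj) (h2 k hk) hm huM
  obtain ⟨c', hc', hgcd⟩ := Finset.univ.extract_gcd u ⟨j, Finset.mem_univ j⟩
  set g := Finset.univ.gcd u with hg
  have hg0 : g ≠ 0 := fun h => huj (Finset.gcd_eq_zero_iff.1 h j (Finset.mem_univ j))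
  let c : ι →₀ ℕ := Finsupp.equivFunOnFinite.symm c'
  have hc (k : ι) : c k = c' k := rfl
  have huc : u = g • c := by
    ext k; rw [Finsupp.smul_apply, smul_eq_mul, hc, hc' k (Finset.mem_univ k)]
  have hcM : c ∈ M := hdiv g hg0 c (huc ▸ huM)
  have hck (k : ι) : c k ≠ 0 ↔ u k ≠ 0 := by
    rw [huc, Finsupp.smul_apply, smul_eq_mul]; simp [hg0]
  refine ⟨c, ⟨hcM, (hck j).2 huj, fun m hm hmj => ?_⟩, fun k hk => htied k ((hck k).1 hk)⟩
  have h4 : ∀ k, c k ≠ 0 → m k * c j = c k * m j := by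
    intro k hk
    have := h3 k ((hck k).1 hk) m hm
    rw [huc, Finsupp.smul_apply, Finsupp.smul_apply, smul_eq_mul, smul_eq_mul] at this
    exact Nat.eq_of_mul_eq_mul_left (Nat.pos_of_ne_zero hg0) (by linarith)
  -- By proportionality `c j` divides `m j * c k` for all `k`, and the entries of `c` have gcd one.
  have hdvd : c j ∣ m j := by
    have : c j ∣ Finset.univ.gcd fun k => m j * c' k := Finset.dvd_gcd fun k _ => by
      by_cases hk : c k = 0
      · rw [← hc, hk, mul_zero]; exact dvd_zero _
      · exact ⟨m k, by rw [← hc, mul_comm (m j), ← h4 k hk, mul_comm]⟩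
    rw [Finset.gcd_mul_left, hgcd] at this
    simpa using this
  obtain ⟨t, ht⟩ := hdvd
  have ht0 : t ≠ 0 := by rintro rfl; exact hmj (by simpa using ht)
  intro k
  by_cases hk : c k = 0
  · simp [hk]
  · have h5 := h4 k hk
    rw [ht] at h5
    have : m k = c k * t := by
      apply Nat.eq_of_mul_eq_mul_right (Nat.pos_of_ne_zero ((hck j).2 huj))
      rw [h5]; ring
    rw [this]
    exact Nat.le_mul_of_pos_right _ (Nat.pos_of_ne_zero ht0)

/-- If the tied coordinates form a stable support and all have least elements, every coordinate
has a least element. -/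
theorem exists_isLeastAt_of_forall_isTied (hsub : ∀ x ∈ M, ∀ y, x + y ∈ M → y ∈ M)
    (hdiv : ∀ N : ℕ, N ≠ 0 → ∀ x, N • x ∈ M → x ∈ M)
    (hst : IsStableSupport M {k | IsTied M k})
    (h : ∀ j, IsTied M j → ∃ c, IsLeastAt M j c ∧ ∀ k, c k ≠ 0 → IsTied M k) (k : ι) :
    ∃ c, IsLeastAt M k c := by
  classical
  by_cases hk : IsTied M k
  · obtain ⟨c, hc, -⟩ := h k hk
    exact ⟨c, hc⟩
  -- Subtracting least elements of tied coordinates lowers the degree without touching the `k`-th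
  -- coordinate. What remains at the end is a multiple of the unit vector at `k`, and saturation
  -- removes the multiple.
  have key : ∀ d : ℕ, ∀ m ∈ M, m.degree = d → m k ≠ 0 → (∀ i, m i ≠ 0 → i = k ∨ IsTied M i) →
      Finsupp.single k 1 ∈ M := by
    intro d
    induction d using Nat.strong_induction_on with
    | _ d ih =>
      intro m hm hmd hmk hmi
      by_cases hj : ∃ j, IsTied M j ∧ m j ≠ 0
      · obtain ⟨j, hj, hmj⟩ := hj
        obtain ⟨c, ⟨hcM, hcj, hcmin⟩, hct⟩ := h j hj
        obtain ⟨y, hy⟩ := exists_add_of_le (hcmin m hm hmj)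
        have hyM : y ∈ M := hsub c hcM y (hy ▸ hm)
        have hck : c k = 0 := by by_contra h; exact hk (hct k h)
        have hcdeg : c.degree ≠ 0 := by
          intro h0
          rw [(Finsupp.degree_eq_zero_iff c).1 h0] at hcj
          exact hcj rfl
        refine ih y.degree ?_ y hyM rfl ?_ fun i hi => hmi i ?_
        · rw [← hmd, hy, map_add]; omega
        · rw [hy, Finsupp.add_apply, hck, zero_add] at hmk; exact hmk
        · rw [hy, Finsupp.add_apply]; omega
      · push Not at hj
        refine hdiv (m k) hmk _ ?_
        have : m k • Finsupp.single k 1 = m := by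
          ext i
          rw [Finsupp.smul_apply]
          by_cases hi : i = k
          · subst hi; simp
          · rw [Finsupp.single_eq_of_ne (by exact hi)]
            have : m i = 0 := by
              by_contra h0
              exact h0 (hj i ((hmi i h0).resolve_left hi))
            simp [this]
        rwa [this]
  obtain ⟨m, hm, hms⟩ := hst (insert k {k | IsTied M k}) (Set.subset_insert _ _)
  refine ⟨Finsupp.single k 1, key _ m hm rfl ((hms k).2 (Set.mem_insert _ _)) fun i hi => by
    simpa using (hms i).1 hi, by simp, fun m' _ hm' => ?_⟩
  rw [Finsupp.single_le_iff]
  omega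

theorem IsLeastAt.eq {k : ι} {c c' : ι →₀ ℕ} (h : IsLeastAt M k c) (h' : IsLeastAt M k c') :
    c = c' := (h.2.2 c' h'.1 h'.2.1).antisymm (h'.2.2 c h.1 h.2.1)

section LeastElements

variable (hsub : ∀ x ∈ M, ∀ y, x + y ∈ M → y ∈ M) (hleast : ∀ k, ∃ c, IsLeastAt M k c)
include hsub hleast

/-- If `m` and `m'` are both positive at `k`, the least element at `k` can be subtracted from both;
induct on degree. -/
theorem inf_mem_of_isLeastAt {m m' : ι →₀ ℕ} (hm : m ∈ M) (hm' : m' ∈ M) : m ⊓ m' ∈ M := by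
  induction hd : m.degree using Nat.strong_induction_on generalizing m m' with
  | _ d ih =>
    by_cases h : m ⊓ m' = 0
    · exact h ▸ M.zero_mem
    · obtain ⟨k, hk⟩ := DFunLike.ne_iff.1 h
      rw [Finsupp.inf_apply, Finsupp.zero_apply] at hk
      obtain ⟨c, hcM, hck, hc⟩ := hleast k
      obtain ⟨y, rfl⟩ := exists_add_of_le (hc m hm (by rintro h0; simp [h0] at hk))
      obtain ⟨y', rfl⟩ := exists_add_of_le (hc m' hm' (by rintro h0; simp [h0] at hk))
      have hcdeg : c.degree ≠ 0 := by
        intro h0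
        rw [(Finsupp.degree_eq_zero_iff c).1 h0] at hck
        exact hck rfl
      have : (c + y) ⊓ (c + y') = c + y ⊓ y' := by
        ext i; simp only [Finsupp.inf_apply, Finsupp.add_apply]; omega
      rw [this]
      rw [map_add] at hd
      exact M.add_mem hcM (ih y.degree (by omega) (hsub c hcM y hm) (hsub c hcM y' hm') rfl)

theorem sup_mem_of_isLeastAt {m m' : ι →₀ ℕ} (hm : m ∈ M) (hm' : m' ∈ M) : m ⊔ m' ∈ M := by
  refine hsub _ (inf_mem_of_isLeastAt hsub hleast hm hm') _ ?_
  have : m ⊓ m' + m ⊔ m' = m + m' := by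
    ext i; simp only [Finsupp.inf_apply, Finsupp.sup_apply, Finsupp.add_apply]; omega
  exact this ▸ M.add_mem hm hm'

/-- Uniqueness of the decomposition into an element of `M` and a reduced exponent. The difference of
`m ⊔ m'` and `m` lies in `M` and below `b`, hence is zero; by symmetry both `m` and `m'` equal their
supremum. -/
theorem eq_of_add_eq_add_of_isLeastAt {m m' b b' : ι →₀ ℕ} (hm : m ∈ M) (hm' : m' ∈ M)
    (hb : ∀ x ∈ M, x ≤ b → x = 0) (hb' : ∀ x ∈ M, x ≤ b' → x = 0) (h : m + b = m' + b') :
    m = m' := by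
  have hs := sup_mem_of_isLeastAt hsub hleast hm hm'
  have key : ∀ x y a : ι →₀ ℕ, x ∈ M → y ∈ M → x ⊔ y ∈ M → (∀ x ∈ M, x ≤ a → x = 0) →
      y ≤ x + a → x = x ⊔ y := by
    intro x y a hx hy hxy ha hle
    obtain ⟨d, hd⟩ := exists_add_of_le (le_sup_left : x ≤ x ⊔ y)
    have hda : d ≤ a := by
      have h1 : x ⊔ y ≤ x + a := sup_le (by simp) hle
      rw [hd] at h1
      exact le_of_add_le_add_left h1
    rw [ha d (hsub x hx d (hd ▸ hxy)) hda, add_zero] at hd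
    exact hd.symm
  rw [key m m' b hm hm' hs hb (h ▸ le_self_add), sup_comm]
  rw [sup_comm] at hs
  exact (key m' m b' hm' hm hs hb' (h ▸ le_self_add)).symm

end LeastElements

/-- Existence of the decomposition: strip nonzero elements of `M` off `e` until none fits below it.
-/
theorem exists_eq_add_of_reduced (M : AddSubmonoid (ι →₀ ℕ)) (e : ι →₀ ℕ) :
    ∃ m ∈ M, ∃ b : ι →₀ ℕ, (∀ x ∈ M, x ≤ b → x = 0) ∧ e = m + b := by
  induction hd : e.degree using Nat.strong_induction_on generalizing e with
  | _ d ih =>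
    by_cases h : ∀ x ∈ M, x ≤ e → x = 0
    · exact ⟨0, M.zero_mem, e, h, (zero_add e).symm⟩
    · push Not at h
      obtain ⟨x, hx, hxe, hx0⟩ := h
      obtain ⟨y, rfl⟩ := exists_add_of_le hxe
      have hxdeg : x.degree ≠ 0 := fun h0 => hx0 ((Finsupp.degree_eq_zero_iff x).1 h0)
      rw [map_add] at hd
      obtain ⟨m, hm, b, hb, rfl⟩ := ih y.degree (by omega) y rfl
      exact ⟨x + m, M.add_mem hx hm, b, hb, (add_assoc _ _ _).symm⟩

variable (M) in
/-- The set of all least elements of `M`. -/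
def leastElements : Set (ι →₀ ℕ) := {c | ∃ k, IsLeastAt M k c}

theorem finite_leastElements [Finite ι] : (leastElements M).Finite := by
  classical
  have : leastElements M ⊆ Set.range fun k => if h : ∃ c, IsLeastAt M k c then h.choose else 0 := by
    rintro c ⟨k, hk⟩
    refine ⟨k, ?_⟩
    have h : ∃ c, IsLeastAt M k c := ⟨c, hk⟩
    simp only [dif_pos h]
    exact h.choose_spec.eq hk
  exact (Set.finite_range _).subset this

variable (M) in
/-- The monoid homomorphism from the free commutative monoid on the least elements. -/
def leastElementsHom : (leastElements M →₀ ℕ) →+ (ι →₀ ℕ) :=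
  Finsupp.liftAddHom fun g => multiplesHom _ g.1

theorem leastElementsHom_single (g : leastElements M) (n : ℕ) :
    leastElementsHom M (Finsupp.single g n) = n • g.1 := by
  simp [leastElementsHom]

/-- If `g` is least at `k`, no other least element is positive at `k`, so the coefficient of `g` can
be read off the `k`-th coordinate. -/
theorem leastElementsHom_injective (hsub : ∀ x ∈ M, ∀ y, x + y ∈ M → y ∈ M) :
    Function.Injective (leastElementsHom M) := by
  intro x y hxy
  ext g
  obtain ⟨k, hk⟩ := g.2
  have hz : ∀ g' : leastElements M, g' ≠ g → g'.1 k = 0 := by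
    intro g' hne
    by_contra h0
    obtain ⟨l, hl⟩ := g'.2
    obtain ⟨d, hd⟩ := exists_add_of_le (hk.2.2 g'.1 hl.1 h0)
    have hdM : d ∈ M := hsub g.1 hk.1 d (hd ▸ hl.1)
    by_cases hdl : d l = 0
    · have : g.1 l ≠ 0 := by
        have := DFunLike.congr_fun hd l
        rw [Finsupp.add_apply, hdl, add_zero] at this
        exact this ▸ hl.2.1
      exact hne (Subtype.ext ((hl.2.2 g.1 hk.1 this).antisymm (hk.2.2 g'.1 hl.1 h0)))
    -- Here `g' ≤ d` while `g' = g + d`, which contradicts `g k ≠ 0`.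
    · have h1 := hl.2.2 d hdM hdl k
      have h2 := DFunLike.congr_fun hd k
      rw [Finsupp.add_apply] at h2
      have := hk.2.1
      omega
  have hval : ∀ z : leastElements M →₀ ℕ, leastElementsHom M z k = z g * g.1 k := by
    intro z
    rw [leastElementsHom, Finsupp.liftAddHom_apply, Finsupp.sum_apply, Finsupp.sum,
      Finset.sum_eq_single g]
    · simp
    · intro b _ hb; simp [hz b hb]
    · intro h; simp [Finsupp.notMem_support_iff.1 h]
  have := DFunLike.congr_fun hxy k
  rw [hval, hval] at this
  exact Nat.eq_of_mul_eq_mul_right (Nat.pos_of_ne_zero hk.2.1) this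

/-- Every nonzero element of `M` lies above some least element; subtract it and induct on degree. -/
theorem mrange_leastElementsHom (hsub : ∀ x ∈ M, ∀ y, x + y ∈ M → y ∈ M)
    (hleast : ∀ k, ∃ c, IsLeastAt M k c) : AddMonoidHom.mrange (leastElementsHom M) = M := by
  refine le_antisymm ?_ fun m hm => ?_
  · rintro _ ⟨x, rfl⟩
    induction x using Finsupp.induction_linear with
    | zero => simp
    | add x y hx hy => rw [map_add]; exact M.add_mem hx hy
    | single g n =>
      obtain ⟨k, hk⟩ := g.2
      rw [leastElementsHom_single]
      exact M.nsmul_mem hk.1 n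
  · induction hd : m.degree using Nat.strong_induction_on generalizing m with
    | _ d ih =>
      by_cases h0 : m = 0
      · exact h0 ▸ AddSubmonoid.zero_mem _
      obtain ⟨k, hk⟩ := DFunLike.ne_iff.1 h0
      obtain ⟨c, hc⟩ := hleast k
      obtain ⟨y, rfl⟩ := exists_add_of_le (hc.2.2 m hm hk)
      have hcdeg : c.degree ≠ 0 := by
        intro h0
        have := hc.2.1
        rw [(Finsupp.degree_eq_zero_iff c).1 h0] at this
        exact this rfl
      rw [map_add] at hd
      refine AddSubmonoid.add_mem _ ⟨Finsupp.single ⟨c, k, hc⟩ 1, ?_⟩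
        (ih y.degree (by omega) y (hsub c hc.1 y hm) rfl)
      rw [leastElementsHom_single, one_smul]

end Monoids

/-! ### Characters and weight vectors of a torus -/

section Weights

variable (K : Type*) [Field K] {r : ℕ}

/-- The character of the torus with exponent vector `a`. -/
def torusChar (a : Fin r → ℤ) : Torus K r →* K where
  toFun t := ((∏ i, t i ^ a i : Kˣ) : K)
  map_one' := by simp
  map_mul' s t := by simp [mul_zpow, Finset.prod_mul_distrib]

variable {K}

theorem torusChar_apply (a : Fin r → ℤ) (t : Torus K r) :
    torusChar K a t = ((∏ i, t i ^ a i : Kˣ) : K) := rfl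

theorem torusChar_ne_zero (a : Fin r → ℤ) (t : Torus K r) : torusChar K a t ≠ 0 :=
  Units.ne_zero _

theorem torusChar_zero (t : Torus K r) : torusChar K (0 : Fin r → ℤ) t = 1 := by
  simp [torusChar_apply]

theorem torusChar_add (a b : Fin r → ℤ) (t : Torus K r) :
    torusChar K (a + b) t = torusChar K a t * torusChar K b t := by
  simp [torusChar_apply, zpow_add, Finset.prod_mul_distrib]

theorem exists_units_zpow_ne_one [Infinite K] {d : ℤ} (hd : d ≠ 0) : ∃ x : Kˣ, x ^ d ≠ 1 := by
  have hn : d.natAbs ≠ 0 := Int.natAbs_ne_zero.2 hd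
  obtain ⟨x, hx⟩ : ∃ x : K, (Polynomial.X * (Polynomial.X ^ d.natAbs - 1) : Polynomial K).eval x ≠ 0 := by
    by_contra! h
    have h0 : (Polynomial.X * (Polynomial.X ^ d.natAbs - 1) : Polynomial K) = 0 :=
      Polynomial.funext (by simpa using h)
    rcases mul_eq_zero.1 h0 with h | h
    · exact Polynomial.X_ne_zero h
    · exact (Polynomial.monic_X_pow_sub_C (1 : K) hn).ne_zero (by simpa using h)
  simp only [Polynomial.eval_mul, Polynomial.eval_X, Polynomial.eval_sub, Polynomial.eval_pow,
    Polynomial.eval_one, ne_eq, mul_eq_zero, not_or] at hx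
  obtain ⟨hx0, hx1⟩ := hx
  refine ⟨Units.mk0 x hx0, fun h => hx1 ?_⟩
  have := congrArg Units.val (pow_natAbs_eq_one.2 h)
  simpa [sub_eq_zero] using this

theorem torusChar_injective [Infinite K] :
    Function.Injective (torusChar K : (Fin r → ℤ) → Torus K r →* K) := by
  intro a b hab
  ext i
  by_contra hne
  obtain ⟨x, hx⟩ := exists_units_zpow_ne_one (K := K) (sub_ne_zero.2 hne)
  have h := DFunLike.congr_fun hab (Pi.mulSingle i x)
  simp only [torusChar_apply, Units.val_inj] at h
  have key (c : Fin r → ℤ) : ∏ j, (Pi.mulSingle i x : Torus K r) j ^ c j = x ^ c i := by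
    rw [Finset.prod_eq_single i]
    · simp
    · intro j _ hj; simp [Pi.mulSingle_eq_of_ne hj]
    · simp
  rw [key, key] at h
  exact hx (by rw [zpow_sub, h, mul_inv_cancel])

/-- Dedekind's independence of characters; an infinite field is needed for distinct exponents to
give distinct characters. -/
theorem linearIndependent_torusChar [Infinite K] :
    LinearIndependent K fun (a : Fin r → ℤ) => (torusChar K a : Torus K r → K) :=
  (linearIndependent_monoidHom (Torus K r) K).comp _ torusChar_injective

/-- Comparison of the coefficients of a character in a function on the torus. -/
theorem sum_filter_eq_of_forall_sum_torusChar [Infinite K] {α : Type*} (s : Finset α)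
    (w : α → Fin r → ℤ) (d : α → K) (κ : K)
    (h : ∀ t : Torus K r, ∑ m ∈ s, d m * torusChar K (w m) t = κ) :
    ∑ m ∈ s with w m = 0, d m = κ := by
  classical
  have hli := linearIndependent_torusChar (K := K) (r := r)
  rw [linearIndependent_iff] at hli
  let l : (Fin r → ℤ) →₀ K := ∑ m ∈ s, Finsupp.single (w m) (d m) - Finsupp.single 0 κ
  have hl : l = 0 := by
    apply hli
    ext t
    simp only [l, map_sub, map_sum, Finsupp.linearCombination_single, Pi.sub_apply,
      Finset.sum_apply, Pi.smul_apply, smul_eq_mul, h t, torusChar_zero, Pi.zero_apply]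
    ring
  have h0 := DFunLike.congr_fun hl 0
  simp only [l, Finsupp.sub_apply, Finsupp.finsetSum_apply, Finsupp.single_apply, Finsupp.zero_apply,
    if_true, sub_eq_zero] at h0
  rw [Finset.sum_filter, h0]

variable {V : Type*} [AddCommGroup V] [Module K V] [FiniteDimensional K V]

/-- A representation of a torus is spanned by weight vectors. -/
theorem span_weightVectors_eq_top [Infinite K] (ρ : Representation K (Torus K r) V)
    (hρ : IsAlgebraic ρ) :
    Submodule.span K {w : V | ∃ a, ∀ t, ρ t w = torusChar K a t • w} = ⊤ := by
  classical
  rw [eq_top_iff]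
  intro v _
  let b := Module.finBasis K V
  have hc (i) : ∃ c : (Fin r → ℤ) →₀ K, ∀ t, b.repr (ρ t v) i = c.sum fun a x => x * torusChar K a t := by
    have := hρ v (b.coord i)
    rw [torusCoordRing, Finsupp.mem_span_range_iff_exists_finsupp] at this
    obtain ⟨c, hc⟩ := this
    refine ⟨c, fun t => ?_⟩
    have := congrFun hc t
    rw [Finsupp.sum, Finset.sum_apply] at this
    exact this.symm
  choose c hc using hc
  let s : Finset (Fin r → ℤ) := Finset.univ.biUnion fun i => (c i).support
  -- `w a` collects the coefficients of the character `a` in the coordinates of `ρ t v`. Comparing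
  -- `ρ t (ρ u v)` with `ρ (t * u) v` as functions of `u` shows that it is a weight vector, and `t =
  -- 1` gives `v = ∑ w a`.
  let w (a : Fin r → ℤ) : V := ∑ i, c i a • b i
  have hw (a i) : b.repr (w a) i = c i a := by
    simp [w, Finsupp.single_apply]
  have hv (t : Torus K r) : ρ t v = ∑ a ∈ s, torusChar K a t • w a := by
    apply b.repr.injective
    ext i
    rw [hc, map_sum, Finsupp.finsetSum_apply, Finsupp.sum]
    simp only [map_smul, Finsupp.smul_apply, hw, smul_eq_mul]
    rw [Finset.sum_subset (Finset.subset_biUnion_of_mem (fun i => (c i).support) (Finset.mem_univ i))]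
    · exact Finset.sum_congr rfl fun a _ => mul_comm _ _
    · intro a _ ha; rw [Finsupp.notMem_support_iff.1 ha, zero_mul]
  have hwt : ∀ a ∈ s, ∀ t, ρ t (w a) = torusChar K a t • w a := by
    intro a ha t
    apply b.repr.injective
    ext i
    have hli := linearIndependent_iff'.1 (linearIndependent_torusChar (K := K) (r := r)) s
      (fun a => b.repr (ρ t (w a)) i - b.repr (torusChar K a t • w a) i) ?_ a ha
    · exact sub_eq_zero.1 hli
    · ext u
      have h1 : ρ t (ρ u v) = ρ (t * u) v := by rw [map_mul]; rfl
      rw [hv u, hv (t * u)] at h1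
      have h2 := congrArg (fun x => b.repr x i) h1
      simp only [map_sum, map_smul, Finsupp.finsetSum_apply, Finsupp.smul_apply, map_mul,
        smul_eq_mul] at h2
      simp only [Finset.sum_apply, Pi.smul_apply, smul_eq_mul, sub_mul, Finset.sum_sub_distrib,
        map_smul, Finsupp.smul_apply, Pi.zero_apply, sub_eq_zero]
      calc _ = ∑ x ∈ s, torusChar K x u * b.repr (ρ t (w x)) i :=
            Finset.sum_congr rfl fun _ _ => mul_comm _ _
        _ = _ := h2
        _ = _ := Finset.sum_congr rfl fun _ _ => by ring
  have h1 := hv 1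
  rw [map_one, Module.End.one_apply] at h1
  rw [h1]
  exact Submodule.sum_mem _ fun a ha => Submodule.smul_mem _ _ (Submodule.subset_span ⟨a, hwt a ha⟩)

theorem exists_weightBasis [Infinite K] (ρ : Representation K (Torus K r) V)
    (hρ : IsAlgebraic ρ) : ∃ (n : ℕ) (b : Module.Basis (Fin n) K V) (a : Fin n → Fin r → ℤ),
      ∀ t i, ρ t (b i) = torusChar K (a i) t • b i := by
  have h := span_weightVectors_eq_top ρ hρ
  let B := Module.Basis.ofSpan h.ge
  have hB (i) : B i ∈ {w : V | ∃ a, ∀ t, ρ t w = torusChar K a t • w} :=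
    Module.Basis.ofSpan_subset h.ge ⟨i, rfl⟩
  have : Finite (LinearIndepOn.extend (linearIndepOn_empty K id) (Set.empty_subset
      {w : V | ∃ a, ∀ t, ρ t w = torusChar K a t • w})) := Module.Finite.finite_basis B
  have := Fintype.ofFinite (LinearIndepOn.extend (linearIndepOn_empty K id) (Set.empty_subset
      {w : V | ∃ a, ∀ t, ρ t w = torusChar K a t • w}))
  choose a ha using hB
  let e := Fintype.equivFin (LinearIndepOn.extend (linearIndepOn_empty K id) (Set.empty_subset
      {w : V | ∃ a, ∀ t, ρ t w = torusChar K a t • w}))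
  exact ⟨_, B.reindex e, fun i => a (e.symm i), fun t i => by
    rw [Module.Basis.reindex_apply]; exact ha _ t⟩

end Weights

/-! ### The coordinate ring as a polynomial ring -/

section Coordinates

variable {K V ι : Type*} [Field K] [AddCommGroup V] [Module K V] [Fintype ι]
  (b : Module.Basis ι K V)

/-- Polynomials in the coordinates of a basis as functions on the vector space. -/
def polyHom : MvPolynomial ι K →ₐ[K] coordRing K V :=
  MvPolynomial.aeval fun i => ⟨fun v => b.coord i v, Algebra.subset_adjoin ⟨b.coord i, rfl⟩⟩

omit [Fintype ι] in
theorem polyHom_apply (p : MvPolynomial ι K) (v : V) :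
    (polyHom b p).1 v = MvPolynomial.eval (fun i => b.repr v i) p := by
  induction p using MvPolynomial.induction_on with
  | C c => rw [← MvPolynomial.algebraMap_eq, AlgHom.commutes]; simp [MvPolynomial.algebraMap_eq]
  | add p q hp hq => rw [map_add, map_add, ← hp, ← hq]; rfl
  | mul_X p i hp =>
    rw [map_mul, map_mul, ← hp, MvPolynomial.eval_X]
    have : polyHom b (MvPolynomial.X i) =
      ⟨fun v => b.coord i v, Algebra.subset_adjoin ⟨b.coord i, rfl⟩⟩ := MvPolynomial.aeval_X _ _
    rw [this]; rfl

theorem polyHom_bijective [Infinite K] : Function.Bijective (polyHom b) := by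
  classical
  constructor
  · intro p q h
    apply MvPolynomial.funext
    intro x
    have hx := congrFun (congrArg Subtype.val h) (∑ i, x i • b i)
    rw [polyHom_apply, polyHom_apply] at hx
    have : (fun i => b.repr (∑ i, x i • b i) i) = x := by
      ext i; simp [Finsupp.single_apply]
    rwa [this] at hx
  · rw [← AlgHom.range_eq_top, eq_top_iff]
    rintro ⟨f, hf⟩ -
    have hle : coordRing K V ≤ (polyHom b).range.map (coordRing K V).val := by
      refine Algebra.adjoin_le ?_
      rintro _ ⟨φ, rfl⟩
      refine ⟨_, ⟨∑ i, MvPolynomial.C (φ (b i)) * MvPolynomial.X i, rfl⟩, ?_⟩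
      ext v
      change (polyHom b _).1 v = φ v
      rw [polyHom_apply]
      have := congrArg φ (b.sum_repr v)
      rw [map_sum] at this
      rw [← this]
      simp [mul_comm]
    obtain ⟨g, hg, hgf⟩ := hle hf
    have : g = ⟨f, hf⟩ := Subtype.ext hgf
    exact this ▸ hg

/-- The coordinate ring is a polynomial ring. -/
def polyEquiv [Infinite K] : MvPolynomial ι K ≃ₐ[K] coordRing K V :=
  AlgEquiv.ofBijective (polyHom b) (polyHom_bijective b)

theorem polyEquiv_apply [Infinite K] (p : MvPolynomial ι K) (v : V) :
    (polyEquiv b p).1 v = MvPolynomial.eval (fun i => b.repr v i) p := polyHom_apply b p v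

theorem eval_polyEquiv_symm [Infinite K] (f : coordRing K V) (v : V) :
    MvPolynomial.eval (fun i => b.repr v i) ((polyEquiv b).symm f) = f.1 v := by
  rw [← polyEquiv_apply, AlgEquiv.apply_symm_apply]

end Coordinates

/-! ### The monoid of invariant exponents -/

section WeightMonoid

variable {ι : Type*} {r : ℕ} (a : ι → Fin r → ℤ)

/-- The weight of a monomial. -/
def weightHom : (ι →₀ ℕ) →+ (Fin r → ℤ) := Finsupp.liftAddHom fun i => multiplesHom _ (a i)

theorem weightHom_apply [Fintype ι] (m : ι →₀ ℕ) : weightHom a m = ∑ i, m i • a i := by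
  rw [weightHom, Finsupp.liftAddHom_apply, Finsupp.sum_fintype _ _ (by simp)]
  simp

/-- The monoid of exponents of invariant monomials. -/
def weightMonoid : AddSubmonoid (ι →₀ ℕ) := AddMonoidHom.mker (weightHom a)

theorem mem_weightMonoid {m : ι →₀ ℕ} : m ∈ weightMonoid a ↔ weightHom a m = 0 := Iff.rfl

theorem weightMonoid_sub : ∀ x ∈ weightMonoid a, ∀ y, x + y ∈ weightMonoid a → y ∈ weightMonoid a := by
  intro x hx y hxy
  rw [mem_weightMonoid] at *
  rwa [map_add, hx, zero_add] at hxy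

theorem weightMonoid_div : ∀ N : ℕ, N ≠ 0 → ∀ x, N • x ∈ weightMonoid a → x ∈ weightMonoid a := by
  intro N hN x hx
  rw [mem_weightMonoid] at *
  rw [map_nsmul] at hx
  exact (smul_eq_zero.1 hx).resolve_left hN

theorem weightMonoid_fg [Finite ι] : (weightMonoid a).FG :=
  AddSubmonoid.fg_of_subtractive (weightMonoid_sub a)

end WeightMonoid

/-! ### Torus action on monomials and invariants -/

section Torus

variable {K V ι : Type*} [Field K] [AddCommGroup V] [Module K V] [Fintype ι] {r : ℕ}
  {ρ : Representation K (Torus K r) V} {b : Module.Basis ι K V} {a : ι → Fin r → ℤ}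
  (hb : ∀ t i, ρ t (b i) = torusChar K (a i) t • b i)

include hb

theorem repr_rho (t : Torus K r) (v : V) (i : ι) :
    b.repr (ρ t v) i = torusChar K (a i) t * b.repr v i := by
  classical
  have := congrArg (fun w => b.repr (ρ t w) i) (b.sum_repr v)
  simp only [map_sum, map_smul, hb, Finsupp.finsetSum_apply, Finsupp.smul_apply, smul_eq_mul] at this
  rw [← this]
  simp [Finsupp.single_apply, mul_comm]

theorem prod_repr_rho (t : Torus K r) (v : V) (m : ι →₀ ℕ) :
    (m.prod fun i e => b.repr (ρ t v) i ^ e) =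
      torusChar K (weightHom a m) t * m.prod fun i e => b.repr v i ^ e := by
  have hch : torusChar K (weightHom a m) t = m.prod fun i e => torusChar K (a i) t ^ e := by
    induction m using Finsupp.induction_linear with
    | zero => simp [torusChar_zero]
    | add x y hx hy =>
      rw [map_add, torusChar_add, hx, hy, Finsupp.prod_add_index']
      · simp
      · intros; rw [pow_add]
    | single i e =>
      rw [Finsupp.prod_single_index (by simp)]
      induction e with
      | zero => simp [torusChar_zero]
      | succ e ih =>
        rw [Finsupp.single_add, map_add, torusChar_add, ih, pow_succ]
        simp [weightHom]
  rw [hch, ← Finsupp.prod_mul]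
  exact Finsupp.prod_congr fun i _ => by rw [repr_rho hb, mul_pow]

theorem eval_rho (p : MvPolynomial ι K) (t : Torus K r) (v : V) :
    MvPolynomial.eval (fun i => b.repr (ρ t v) i) p =
      ∑ m ∈ p.support, (p.coeff m * m.prod fun i e => b.repr v i ^ e) *
        torusChar K (weightHom a m) t := by
  rw [MvPolynomial.eval_eq']
  refine Finset.sum_congr rfl fun m _ => ?_
  have := prod_repr_rho hb t v m
  rw [Finsupp.prod_fintype _ _ (by simp)] at this
  rw [this]; ring

omit hb in
variable (a) in
/-- The weight zero part of a polynomial. -/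
def weightZeroPart (p : MvPolynomial ι K) : MvPolynomial ι K :=
  ∑ m ∈ p.support with weightHom a m = 0, MvPolynomial.monomial m (p.coeff m)

omit [Fintype ι] hb in
theorem coeff_weightZeroPart (p : MvPolynomial ι K) {m : ι →₀ ℕ} (hm : m ∉ weightMonoid a) :
    (weightZeroPart a p).coeff m = 0 := by
  classical
  rw [weightZeroPart, MvPolynomial.coeff_sum]
  refine Finset.sum_eq_zero fun m' hm' => ?_
  rw [MvPolynomial.coeff_monomial, if_neg]
  rintro rfl
  exact hm (Finset.mem_filter.1 hm').2

/-- The weight zero part plays the role of the Reynolds operator. Along an orbit a polynomial is a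
combination of characters of `t`; if it is constant, independence of characters leaves only the
trivial one. -/
theorem eval_weightZeroPart [Infinite K] {p : MvPolynomial ι K} {v : V} {κ : K}
    (h : ∀ t, MvPolynomial.eval (fun i => b.repr (ρ t v) i) p = κ) :
    MvPolynomial.eval (fun i => b.repr v i) (weightZeroPart a p) = κ := by
  simp only [eval_rho hb] at h
  rw [weightZeroPart, map_sum]
  simp only [MvPolynomial.eval_monomial]
  exact sum_filter_eq_of_forall_sum_torusChar _ _ _ κ h

theorem eval_rho_eq {p : MvPolynomial ι K} (hp : ∀ m, p.coeff m ≠ 0 → m ∈ weightMonoid a)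
    (t : Torus K r) (v : V) :
    MvPolynomial.eval (fun i => b.repr (ρ t v) i) p = MvPolynomial.eval (fun i => b.repr v i) p := by
  rw [eval_rho hb, MvPolynomial.eval_eq']
  refine Finset.sum_congr rfl fun m hm => ?_
  rw [(mem_weightMonoid a).1 (hp m (MvPolynomial.mem_support_iff.1 hm)), torusChar_zero, mul_one,
    Finsupp.prod_fintype _ _ (by simp)]

/-- The invariants are the polynomials all of whose monomials have weight zero. -/
theorem polyEquiv_mem_invariants_iff [Infinite K] (p : MvPolynomial ι K) :
    polyEquiv b p ∈ invariants ρ ↔ ∀ m, p.coeff m ≠ 0 → m ∈ weightMonoid a := by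
  classical
  constructor
  · intro h m hm
    by_contra hmM
    have : weightZeroPart a p = p := by
      apply (polyEquiv b).injective
      ext v
      rw [polyEquiv_apply, polyEquiv_apply]
      apply eval_weightZeroPart hb
      intro t
      rw [← polyEquiv_apply, ← polyEquiv_apply]
      exact h t v
    rw [← this] at hm
    exact hm (coeff_weightZeroPart p hmM)
  · intro h t v
    rw [polyEquiv_apply, polyEquiv_apply]
    exact eval_rho_eq hb h t v

end Torus

/-! ### Zariski closure and separation by polynomials -/

section Zariski

variable {K V ι : Type*} [Field K] [AddCommGroup V] [Module K V] [Fintype ι]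

theorem isTopologicalBasis_zariski : @TopologicalSpace.IsTopologicalBasis V (zariski K V)
    {U | ∃ f ∈ coordRing K V, U = {v | f v ≠ 0}} := by
  let _ := zariski K V
  refine ⟨?_, ?_, rfl⟩
  · rintro _ ⟨f, hf, rfl⟩ _ ⟨g, hg, rfl⟩ x ⟨hfx, hgx⟩
    refine ⟨_, ⟨f * g, mul_mem hf hg, rfl⟩, mul_ne_zero hfx hgx, fun y hy => ?_⟩
    exact ⟨left_ne_zero_of_mul hy, right_ne_zero_of_mul hy⟩
  · refine Set.eq_univ_of_forall fun x => ⟨_, ⟨1, one_mem _, rfl⟩, ?_⟩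
    simp

theorem mem_closure_zariski_iff {Y : Set V} {v : V} :
    v ∈ closure[zariski K V] Y ↔ ∀ f ∈ coordRing K V, (∀ y ∈ Y, f y = 0) → f v = 0 := by
  let _ := zariski K V
  rw [isTopologicalBasis_zariski.mem_closure_iff]
  constructor
  · intro h f hf hY
    by_contra hv
    obtain ⟨y, hy, hyY⟩ := h _ ⟨f, hf, rfl⟩ hv
    exact hy (hY y hyY)
  · rintro h _ ⟨f, hf, rfl⟩ hv
    by_contra hne
    refine hv (h f hf fun y hy => ?_)
    by_contra hfy
    exact hne ⟨y, hfy, hy⟩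

variable (b : Module.Basis ι K V)

theorem mem_closure_zariski_iff_eval [Infinite K] {Y : Set V} {v : V} :
    v ∈ closure[zariski K V] Y ↔ ∀ p : MvPolynomial ι K,
      (∀ y ∈ Y, MvPolynomial.eval (fun i => b.repr y i) p = 0) →
        MvPolynomial.eval (fun i => b.repr v i) p = 0 := by
  rw [mem_closure_zariski_iff]
  constructor
  · intro h p hp
    rw [← polyEquiv_apply]
    refine h _ (polyEquiv b p).2 fun y hy => ?_
    rw [polyEquiv_apply]
    exact hp y hy
  · intro h f hf hY
    have hev := eval_polyEquiv_symm b ⟨f, hf⟩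
    change ∀ v, _ = f v at hev
    rw [← hev]
    refine h _ fun y hy => ?_
    rw [hev]
    exact hY y hy

/-- A set disjoint from the zero locus of an ideal is separated from it by a polynomial. -/
theorem exists_mem_eval_eq_one [IsAlgClosed K] {Y : Set V} (J : Ideal (MvPolynomial ι K))
    (h : ∀ v ∈ closure[zariski K V] Y, ∃ p ∈ J, MvPolynomial.eval (fun i => b.repr v i) p ≠ 0) :
    ∃ p ∈ J, ∀ y ∈ Y, MvPolynomial.eval (fun i => b.repr y i) p = 1 := by
  classical
  have := IsAlgClosed.instInfinite (K := K)
  let I : Ideal (MvPolynomial ι K) :=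
    ⨅ y ∈ Y, RingHom.ker (MvPolynomial.eval (fun i => b.repr y i))
  have hI (p) : p ∈ I ↔ ∀ y ∈ Y, MvPolynomial.eval (fun i => b.repr y i) p = 0 := by
    simp only [I, Submodule.mem_iInf]; rfl
  -- By the Nullstellensatz a maximal ideal containing both would be a point of the closure of `Y`
  -- at which all of `J` vanishes.
  have htop : I ⊔ J = ⊤ := by
    by_contra hne
    obtain ⟨m, hm, hle⟩ := Ideal.exists_le_maximal _ hne
    obtain ⟨x, hx⟩ := (MvPolynomial.isMaximal_iff_eq_vanishingIdeal_singleton (K := K)).1 hm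
    have hmem (p) (hp : p ∈ m) : MvPolynomial.eval x p = 0 := by
      rw [hx, MvPolynomial.mem_vanishingIdeal_singleton_iff] at hp
      simpa using hp
    have hrepr : (fun i => b.repr (∑ i, x i • b i) i) = x := by
      ext i; simp [Finsupp.single_apply]
    obtain ⟨p, hp, hpv⟩ := h (∑ i, x i • b i) ((mem_closure_zariski_iff_eval b).2 fun p hp => by
      rw [hrepr]; exact hmem p (hle (Ideal.mem_sup_left ((hI p).2 hp))))
    rw [hrepr] at hpv
    exact hpv (hmem p (hle (Ideal.mem_sup_right hp)))
  obtain ⟨q, hq, p, hp, hqp⟩ := Submodule.mem_sup.1 (htop ▸ Submodule.mem_top : (1 : MvPolynomial ι K) ∈ I ⊔ J)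
  refine ⟨p, hp, fun y hy => ?_⟩
  have := congrArg (MvPolynomial.eval (fun i => b.repr y i)) hqp
  rwa [map_add, (hI q).1 hq y hy, zero_add, map_one] at this

end Zariski

/-! ### Stable vectors and their supports -/

section Orbits

variable {K V ι : Type*} [Field K] [AddCommGroup V] [Module K V] [Fintype ι] {r : ℕ}
  {ρ : Representation K (Torus K r) V} {b : Module.Basis ι K V} {a : ι → Fin r → ℤ}

theorem rho_mul_apply (s t : Torus K r) (v : V) : ρ s (ρ t v) = ρ (s * t) v := by
  rw [map_mul]; rfl

theorem self_mem_orbit (v : V) : v ∈ orbit ρ v := ⟨1, by simp⟩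

theorem orbit_rho (t : Torus K r) (v : V) : orbit ρ (ρ t v) = orbit ρ v := by
  ext w
  constructor
  · rintro ⟨s, rfl⟩; exact ⟨s * t, (rho_mul_apply s t v).symm⟩
  · rintro ⟨s, rfl⟩; exact ⟨s * t⁻¹, by simp⟩

/-- A linear system of multiplicative equations over an algebraically closed field is solvable
when it is consistent. -/
theorem exists_torus_of_forall_prod_eq_one [IsAlgClosed K] {α : Type*} [Fintype α]
    (a : α → Fin r → ℤ) (z : α → Kˣ)
    (h : ∀ l : α → ℤ, ∑ i, l i • a i = 0 → ∏ i, z i ^ l i = 1) :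
    ∃ t : Torus K r, ∀ i, ∏ j, t j ^ a i j = z i := by
  classical
  let _ : DivisibleBy (Additive Kˣ) ℕ := divisibleByOfSMulRightSurj _ _ fun {n} hn x => by
    obtain ⟨y, hy⟩ := IsAlgClosed.exists_pow_nat_eq ((Additive.toMul x : Kˣ) : K)
      (Nat.pos_of_ne_zero hn)
    have hy0 : y ≠ 0 := by
      rintro rfl
      rw [zero_pow hn] at hy
      exact (Additive.toMul x).ne_zero hy.symm
    refine ⟨Additive.ofMul (Units.mk0 y hy0), Additive.toMul.injective (Units.ext ?_)⟩
    simpa using hy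
  let _ : DivisibleBy (Additive Kˣ) ℤ := AddGroup.divisibleByIntOfDivisibleByNat _
  -- `l ↦ ∏ z i ^ l i` factors through the image of `l ↦ ∑ l i • a i`. The group `Kˣ` is divisible,
  -- hence injective, so the factored map extends to `ℤʳ`; its values on the standard basis are the
  -- coordinates of `t`.
  have hB : Module.Baer ℤ (Additive Kˣ) := Module.Baer.of_divisible _
  let W : (α → ℤ) →ₗ[ℤ] (Fin r → ℤ) := Fintype.linearCombination ℤ a
  let Z : (α → ℤ) →ₗ[ℤ] Additive Kˣ := Fintype.linearCombination ℤ fun i => Additive.ofMul (z i)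
  have hker : LinearMap.ker W ≤ LinearMap.ker Z := by
    intro l hl
    rw [LinearMap.mem_ker] at hl ⊢
    simp only [W, Z, Fintype.linearCombination_apply] at hl ⊢
    have := congrArg Additive.ofMul (h l hl)
    simpa using this
  obtain ⟨g, hg⟩ := hB.extension_property
    ((LinearMap.ker W).liftQ W le_rfl) (LinearMap.ker_eq_bot.1 (Submodule.ker_liftQ_eq_bot _ _ _ le_rfl))
    ((LinearMap.ker W).liftQ Z hker)
  refine ⟨fun j => (g (Pi.single j 1)).toMul, fun i => ?_⟩
  have h1 := LinearMap.congr_fun hg (Submodule.Quotient.mk (Pi.single i 1))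
  rw [LinearMap.comp_apply, Submodule.liftQ_apply, Submodule.liftQ_apply] at h1
  simp only [W, Z, Fintype.linearCombination_apply_single, one_smul] at h1
  have h2 : a i = ∑ j, a i j • (Pi.single j 1 : Fin r → ℤ) := by
    ext k; simp [Pi.single_apply]
  rw [h2, map_sum] at h1
  simp only [map_smul] at h1
  have h3 := congrArg Additive.toMul h1
  simpa using h3

variable (hb : ∀ t i, ρ t (b i) = torusChar K (a i) t • b i)
include hb

/-- The ratios of the coordinates of `w` and `v` must satisfy every integer relation among the
weights in the common support. Adding a large multiple of `m₀`, positive exactly there, turns a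
relation into an invariant monomial, on which `v` and `w` agree. -/
theorem exists_rho_eq [IsAlgClosed K] {v w : V} (hvw : ∀ i, b.repr v i ≠ 0 ↔ b.repr w i ≠ 0)
    {m₀ : ι →₀ ℕ} (hm₀ : m₀ ∈ weightMonoid a) (hm₀v : ∀ i, m₀ i ≠ 0 ↔ b.repr v i ≠ 0)
    (h : ∀ m ∈ weightMonoid a,
      (m.prod fun i e => b.repr v i ^ e) = m.prod fun i e => b.repr w i ^ e) :
    ∃ t, ρ t v = w := by
  classical
  let S : Type _ := {i // b.repr v i ≠ 0}
  let z : S → Kˣ := fun i => Units.mk0 (b.repr w i) ((hvw i).1 i.2) / Units.mk0 (b.repr v i) i.2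
  obtain ⟨t, ht⟩ := exists_torus_of_forall_prod_eq_one (fun i : S => a i) z (by
    have key : ∀ m ∈ weightMonoid a, (∀ i, b.repr v i = 0 → m i = 0) →
        ∏ i : S, z i ^ (m i : ℤ) = 1 := by
      intro m hm hmv
      have hsub (u : V) : (m.prod fun i e => b.repr u i ^ e) = ∏ i : S, b.repr u i ^ m i := by
        rw [Finsupp.prod_fintype _ _ (by simp)]
        rw [← Finset.prod_filter_of_ne (p := fun i => b.repr v i ≠ 0),
          Finset.prod_subtype (p := fun i => b.repr v i ≠ 0) _ (by simp)]
        intro i _ hne hi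
        rw [hmv i hi, pow_zero] at hne
        exact hne rfl
      have h1 := h m hm
      rw [hsub, hsub] at h1
      ext
      simp only [z, zpow_natCast, div_pow, Finset.prod_div_distrib, Units.val_div_eq_div_val,
        Units.coe_prod, Units.val_pow_eq_pow_val, Units.val_mk0, Units.val_one]
      rw [h1, div_self]
      exact Finset.prod_ne_zero_iff.2 fun i _ => pow_ne_zero _ ((hvw i).1 i.2)
    intro l hl
    -- Since `m₀` is at least one on the support, this `N` makes all exponents `l i + N * m₀ i`
    -- nonnegative.
    let N : ℕ := ∑ i, (l i).natAbs
    have hN (i : S) : 0 ≤ l i + N * m₀ i := by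
      have h1 : (l i).natAbs ≤ N := Finset.single_le_sum (f := fun i => (l i).natAbs) (by simp)
        (Finset.mem_univ i)
      have h2 : 1 ≤ m₀ i := Nat.one_le_iff_ne_zero.2 ((hm₀v i).2 i.2)
      have h3 : N ≤ N * m₀ i := Nat.le_mul_of_pos_right _ h2
      have h4 : ((N * m₀ i : ℕ) : ℤ) = N * m₀ i := by push_cast; ring
      omega
    let m : ι →₀ ℕ := Finsupp.equivFunOnFinite.symm fun i =>
      if hi : b.repr v i ≠ 0 then (l ⟨i, hi⟩ + N * m₀ i).toNat else 0
    have hmi (i : S) : (m i : ℤ) = l i + N * m₀ i := by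
      have : m i = (l i + N * m₀ i).toNat := by
        simp only [m, Finsupp.equivFunOnFinite_symm_apply_apply]
        rw [dif_pos i.2]
      rw [this, Int.toNat_of_nonneg (hN i)]
    have hm0 (i : ι) (hi : b.repr v i = 0) : m i = 0 := by
      simp only [m, Finsupp.equivFunOnFinite_symm_apply_apply]
      rw [dif_neg (by simpa using hi)]
    have hwt (m' : ι →₀ ℕ) (h' : ∀ i, b.repr v i = 0 → m' i = 0) :
        weightHom a m' = ∑ i : S, (m' i : ℤ) • a i := by
      have e1 : ∑ i, m' i • a i = ∑ i with b.repr v i ≠ 0, m' i • a i := by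
        refine (Finset.sum_filter_of_ne fun i _ hne hi => ?_).symm
        rw [h' i hi, zero_smul] at hne
        exact hne rfl
      rw [weightHom_apply, e1, Finset.sum_subtype (F := inferInstanceAs (Fintype S))
        (p := fun i => b.repr v i ≠ 0) _ (by simp)]
      exact Finset.sum_congr rfl fun i _ => (natCast_zsmul _ _).symm
    have hmM : m ∈ weightMonoid a := by
      have h0 : weightHom a m₀ = 0 := hm₀
      rw [mem_weightMonoid, hwt m hm0]
      rw [hwt m₀ fun i hi => by by_contra hne; exact (hm₀v i).1 hne hi] at h0
      simp only [hmi, add_smul, Finset.sum_add_distrib, hl, mul_smul, ← Finset.smul_sum, h0]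
      simp
    have h1 := key m hmM hm0
    have h2 := key m₀ hm₀ fun i hi => by by_contra hne; exact (hm₀v i).1 hne hi
    simp only [hmi, zpow_add, Finset.prod_mul_distrib] at h1
    have h3 : ∏ i : S, z i ^ ((N : ℤ) * m₀ i) = 1 := by
      simp only [mul_comm (N : ℤ), zpow_mul, Finset.prod_zpow, h2, one_zpow]
    rwa [h3, mul_one] at h1)
  refine ⟨t, b.repr.injective ?_⟩
  ext i
  rw [repr_rho hb]
  by_cases hi : b.repr v i = 0
  · have : b.repr w i = 0 := by by_contra hw; exact (hvw i).2 hw hi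
    rw [hi, this, mul_zero]
  · rw [torusChar_apply, ht ⟨i, hi⟩]
    simp only [z, Units.val_div_eq_div_val, Units.val_mk0]
    exact div_mul_cancel₀ _ hi

omit [Fintype ι] hb in
theorem eval_monomial_one (m : ι →₀ ℕ) (v : V) :
    MvPolynomial.eval (fun i => b.repr v i) (MvPolynomial.monomial m 1) =
      m.prod fun i e => b.repr v i ^ e := by
  rw [MvPolynomial.eval_monomial, one_mul]

omit hb in
theorem prod_repr_ne_zero_iff {m : ι →₀ ℕ} {v : V} :
    (m.prod fun i e => b.repr v i ^ e) ≠ 0 ↔ ∀ i, m i ≠ 0 → b.repr v i ≠ 0 := by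
  rw [Finsupp.prod_fintype _ _ (by simp), Finset.prod_ne_zero_iff]
  refine forall_congr' fun i => ?_
  by_cases hm : m i = 0
  · simp [hm]
  · simp [hm]

theorem eval_eq_of_mem_closure [Infinite K] {p : MvPolynomial ι K} {v w : V}
    (h : v ∈ closure[zariski K V] (orbit ρ w))
    (hp : ∀ m, p.coeff m ≠ 0 → m ∈ weightMonoid a) :
    MvPolynomial.eval (fun i => b.repr v i) p = MvPolynomial.eval (fun i => b.repr w i) p := by
  have := (mem_closure_zariski_iff_eval b).1 h
    (p - MvPolynomial.C (MvPolynomial.eval (fun i => b.repr w i) p)) ?_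
  · simpa [sub_eq_zero] using this
  · rintro _ ⟨t, rfl⟩
    rw [map_sub, MvPolynomial.eval_C, sub_eq_zero]
    exact eval_rho_eq hb hp t w

theorem prod_repr_eq_of_mem_closure [Infinite K] {m : ι →₀ ℕ} {v w : V}
    (h : v ∈ closure[zariski K V] (orbit ρ w)) (hm : m ∈ weightMonoid a) :
    (m.prod fun i e => b.repr v i ^ e) = m.prod fun i e => b.repr w i ^ e := by
  classical
  rw [← eval_monomial_one, ← eval_monomial_one]
  refine eval_eq_of_mem_closure hb h fun m' hm' => ?_
  rw [MvPolynomial.coeff_monomial] at hm'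
  have : m = m' := by by_contra h; simp [h] at hm'
  exact this ▸ hm

/-- Invariant monomials take equal values at a vector and at points of the closure of its orbit. A
monomial whose support is the whole support of one vector thus forces that support into the other's;
once the supports agree, `exists_rho_eq` puts both vectors in one orbit. -/
theorem isStableVector_of_isStableSupport [IsAlgClosed K] {v : V}
    (h : IsStableSupport (weightMonoid a) {i | b.repr v i ≠ 0}) : IsStableVector ρ v := by
  have := IsAlgClosed.instInfinite (K := K)
  obtain ⟨m₀, hm₀, hm₀v⟩ := h _ subset_rfl
  have hv0 : (m₀.prod fun i e => b.repr v i ^ e) ≠ 0 :=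
    prod_repr_ne_zero_iff.2 fun i hi => (hm₀v i).1 hi
  constructor
  · let _ := zariski K V
    refine closure_subset_iff_isClosed.1 fun u hu => ?_
    have hinv : ∀ m ∈ weightMonoid a, _ := fun m hm => prod_repr_eq_of_mem_closure hb hu hm
    refine exists_rho_eq hb (fun i => ⟨fun hi => ?_, fun hi hv => hi ?_⟩) hm₀ hm₀v
      fun m hm => (hinv m hm).symm
    · exact prod_repr_ne_zero_iff.1 (hinv m₀ hm₀ ▸ hv0) i ((hm₀v i).2 hi)
    · have := (mem_closure_zariski_iff_eval b).1 hu (MvPolynomial.X i) ?_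
      · simpa using this
      · rintro _ ⟨t, rfl⟩
        rw [MvPolynomial.eval_X, repr_rho hb, hv, mul_zero]
  · intro w hw
    have hinv : ∀ m ∈ weightMonoid a, _ := fun m hm => prod_repr_eq_of_mem_closure hb hw hm
    have hvw (i) (hi : b.repr v i ≠ 0) : b.repr w i ≠ 0 :=
      prod_repr_ne_zero_iff.1 (hinv m₀ hm₀ ▸ hv0) i ((hm₀v i).2 hi)
    obtain ⟨m', hm', hm'w⟩ := h {i | b.repr w i ≠ 0} hvw
    have hw0 : (m'.prod fun i e => b.repr w i ^ e) ≠ 0 :=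
      prod_repr_ne_zero_iff.2 fun i hi => (hm'w i).1 hi
    obtain ⟨t, rfl⟩ := exists_rho_eq hb (fun i => ⟨hvw i, fun hi =>
      prod_repr_ne_zero_iff.1 (hinv m' hm' ▸ hw0) i ((hm'w i).2 hi)⟩) hm₀ hm₀v hinv
    exact orbit_rho t v

/-- Translation by `t` acts on polynomials by rescaling the variables, so it preserves the vanishing
conditions that define the closure of an orbit. -/
theorem rho_mem_closure_orbit [Infinite K] {v w : V} (t : Torus K r)
    (h : v ∈ closure[zariski K V] (orbit ρ w)) : ρ t v ∈ closure[zariski K V] (orbit ρ w) := by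
  rw [mem_closure_zariski_iff_eval b] at h ⊢
  intro p hp
  have key (u : V) : MvPolynomial.eval (fun i => b.repr (ρ t u) i) p =
      MvPolynomial.eval (fun i => b.repr u i)
        (MvPolynomial.aeval (fun i => MvPolynomial.C (torusChar K (a i) t) * MvPolynomial.X i) p) := by
    rw [MvPolynomial.aeval_def, MvPolynomial.eval_eval₂]
    simp only [map_mul, MvPolynomial.eval_C, MvPolynomial.eval_X, repr_rho hb]
    rw [MvPolynomial.eval, ← MvPolynomial.coe_eval₂Hom]
    congr 2
    ext x
    simp
  rw [key]
  refine h _ ?_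
  rintro _ ⟨s, rfl⟩
  rw [← key, rho_mul_apply]
  exact hp _ ⟨t * s, rfl⟩

/-- Separating polynomials are replaced by their weight zero parts, and a single monomial of the
result is extracted. One such monomial has exactly the support of `v`; for each further coordinate
`k`, another involves `k` and otherwise only the support of `v`. Sums of these exponents realize
every larger support. -/
theorem isStableSupport_of_isStableVector [IsAlgClosed K] {v : V} (h : IsStableVector ρ v) :
    IsStableSupport (weightMonoid a) {i | b.repr v i ≠ 0} := by
  classical
  have := IsAlgClosed.instInfinite (K := K)
  have hclosed : ∀ u ∈ closure[zariski K V] (orbit ρ v), u ∈ orbit ρ v := by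
    let _ := zariski K V
    exact fun u hu => h.1.closure_eq ▸ hu
  have hsupp (t : Torus K r) (u : V) (i : ι) : b.repr (ρ t u) i = 0 ↔ b.repr u i = 0 := by
    rw [repr_rho hb, mul_eq_zero, or_iff_right (torusChar_ne_zero _ _)]
  have hpart (p : MvPolynomial ι K)
      (hp : ∀ y ∈ orbit ρ v, MvPolynomial.eval (fun i => b.repr y i) p = 1) :
      MvPolynomial.eval (fun i => b.repr v i) (weightZeroPart a p) = 1 :=
    eval_weightZeroPart hb fun t => hp _ ⟨t, rfl⟩
  have h0 : ∃ m ∈ weightMonoid a, ∀ i, m i ≠ 0 ↔ b.repr v i ≠ 0 := by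
    -- The squarefree monomial on the support of `v` vanishes nowhere on the closed orbit, so some
    -- multiple of it equals one there. Every monomial of that multiple involves the full support.
    let x : ι →₀ ℕ := Finsupp.equivFunOnFinite.symm fun i => if b.repr v i = 0 then 0 else 1
    have hx (i) : x i = if b.repr v i = 0 then 0 else 1 := rfl
    obtain ⟨p, hp, hp1⟩ := exists_mem_eval_eq_one b (Y := orbit ρ v)
      (Ideal.span {MvPolynomial.monomial x (1 : K)}) (by
        intro u hu
        obtain ⟨t, rfl⟩ := hclosed u hu
        refine ⟨_, Ideal.mem_span_singleton_self _, ?_⟩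
        rw [eval_monomial_one, prod_repr_ne_zero_iff]
        intro i hi
        rw [ne_eq, hsupp]
        intro hi0
        rw [hx, if_pos hi0] at hi
        exact hi rfl)
    have h1 := hpart p hp1
    rw [weightZeroPart, map_sum] at h1
    obtain ⟨m, hm, hm1⟩ := Finset.exists_ne_zero_of_sum_ne_zero (h1 ▸ one_ne_zero)
    rw [MvPolynomial.eval_monomial] at hm1
    rw [Finset.mem_filter, MvPolynomial.mem_support_iff] at hm
    refine ⟨m, hm.2, fun i => ⟨prod_repr_ne_zero_iff.1 (right_ne_zero_of_mul hm1) i, fun hi => ?_⟩⟩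
    obtain ⟨q, rfl⟩ := Ideal.mem_span_singleton.1 hp
    have hle : x ≤ m := by
      by_contra hle
      have := MvPolynomial.coeff_monomial_mul' m x 1 q
      rw [if_neg hle] at this
      exact hm.1 this
    have := hle i
    rw [hx, if_neg hi] at this
    omega
  obtain ⟨m₀, hm₀, hm₀v⟩ := h0
  have h1 : ∀ k, b.repr v k = 0 → ∃ m ∈ weightMonoid a, m k ≠ 0 ∧
      ∀ i, m i ≠ 0 → i = k ∨ b.repr v i ≠ 0 := by
    intro k hk
    -- `w` has strictly larger support than `v`, so by stability `v` is not in the closure of its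
    -- orbit. Hence some invariant monomial takes different values at `v` and `w`, and it must
    -- involve `k`.
    let w := v + b k
    have hw (i) : b.repr w i = if i = k then 1 else b.repr v i := by
      simp only [w, map_add, Finsupp.add_apply, Module.Basis.repr_self, Finsupp.single_apply]
      split_ifs with h1 h2 h2
      · rw [← h1, hk, zero_add]
      · exact absurd h1.symm h2
      · exact absurd h2.symm h1
      · rw [add_zero]
    let J : Ideal (MvPolynomial ι K) :=
      ⨅ y ∈ orbit ρ w, RingHom.ker (MvPolynomial.eval (fun i => b.repr y i))
    have hJ (p) : p ∈ J ↔ ∀ y ∈ orbit ρ w, MvPolynomial.eval (fun i => b.repr y i) p = 0 := by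
      simp only [J, Submodule.mem_iInf]; rfl
    obtain ⟨p, hp, hp1⟩ := exists_mem_eval_eq_one b (Y := orbit ρ v) J (by
        intro u hu
        obtain ⟨t, rfl⟩ := hclosed u hu
        by_contra! hcon
        have hmem : ρ t v ∈ closure[zariski K V] (orbit ρ w) :=
          (mem_closure_zariski_iff_eval b).2 fun p hp => hcon p ((hJ p).2 hp)
        have hmem' := rho_mem_closure_orbit hb t⁻¹ hmem
        rw [rho_mul_apply, inv_mul_cancel, map_one, Module.End.one_apply] at hmem'
        have : w ∈ orbit ρ v := h.2 w hmem' ▸ self_mem_orbit w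
        obtain ⟨s, hs⟩ := this
        have h2 := (hsupp s v k).2 hk
        change ρ s v = w at hs
        rw [hs, hw, if_pos rfl] at h2
        exact one_ne_zero h2)
    have h2 := hpart p hp1
    have h3 : MvPolynomial.eval (fun i => b.repr w i) (weightZeroPart a p) = 0 :=
      eval_weightZeroPart hb fun t => (hJ p).1 hp _ ⟨t, rfl⟩
    have h4 := congrArg₂ (· - ·) h2 h3
    simp only [weightZeroPart, map_sum, ← Finset.sum_sub_distrib, sub_zero,
      MvPolynomial.eval_monomial, ← mul_sub] at h4
    obtain ⟨m, hm, hm1⟩ := Finset.exists_ne_zero_of_sum_ne_zero (h4 ▸ one_ne_zero)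
    have hm2 := right_ne_zero_of_mul hm1
    rw [sub_ne_zero] at hm2
    rw [Finset.mem_filter] at hm
    refine ⟨m, hm.2, fun hmk => hm2 ?_, fun i hi => ?_⟩
    · refine Finsupp.prod_congr fun i hi => ?_
      rw [hw, if_neg]
      rintro rfl
      exact (Finsupp.mem_support_iff.1 hi) hmk
    · by_contra! hcon
      refine hm2 ?_
      have e1 : (m.prod fun i e => b.repr v i ^ e) = 0 := by
        by_contra hne
        exact prod_repr_ne_zero_iff.1 hne i hi hcon.2
      have e2 : (m.prod fun i e => b.repr w i ^ e) = 0 := by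
        by_contra hne
        refine prod_repr_ne_zero_iff.1 hne i hi ?_
        rw [hw, if_neg hcon.1, hcon.2]
      rw [e1, e2]
  choose! f hfM hfk hfi using h1
  intro S' hS'
  refine ⟨m₀ + ∑ k with k ∈ S' ∧ b.repr v k = 0, f k, add_mem hm₀ (sum_mem fun k hk =>
    hfM k (Finset.mem_filter.1 hk).2.2), fun i => ?_⟩
  rw [Finsupp.add_apply, Finsupp.finsetSum_apply]
  constructor
  · intro hi
    rcases Nat.add_eq_zero_iff.not.1 hi |> not_and_or.1 with h2 | h2
    · exact hS' ((hm₀v i).1 h2)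
    · obtain ⟨k, hk, hki⟩ := Finset.exists_ne_zero_of_sum_ne_zero h2
      rw [Finset.mem_filter] at hk
      rcases hfi k hk.2.2 i hki with rfl | h3
      · exact hk.2.1
      · exact hS' h3
  · intro hi
    by_cases hv : b.repr v i = 0
    · have : f i i ≤ ∑ k with k ∈ S' ∧ b.repr v k = 0, f k i :=
        Finset.single_le_sum (f := fun k => f k i) (by simp) (by simp [hi, hv])
      have := hfk i hv
      omega
    · have := (hm₀v i).2 hv
      omega

/-- A vector is stable if and only if its support is a stable support. -/
theorem isStableVector_iff [IsAlgClosed K] {v : V} :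
    IsStableVector ρ v ↔ IsStableSupport (weightMonoid a) {i | b.repr v i ≠ 0} :=
  ⟨isStableSupport_of_isStableVector hb, isStableVector_of_isStableSupport hb⟩

end Orbits

/-! ### Coordinate subspaces: irreducibility and codimension -/

section CoordinateSubspaces

variable {K V ι : Type*} [Field K] [AddCommGroup V] [Module K V] [Fintype ι]
  (b : Module.Basis ι K V)

/-- The coordinate subspace where the coordinates in `C` vanish. -/
def coordSubspace (C : Set ι) : Set V := {v | ∀ i ∈ C, b.repr v i = 0}

open Classical in
/-- The vector whose coordinates are one on `S` and zero elsewhere. -/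
def indicatorVector (S : Set ι) : V := ∑ i with i ∈ S, b i

theorem repr_indicatorVector (S : Set ι) (i : ι) [Decidable (i ∈ S)] :
    b.repr (indicatorVector b S) i = if i ∈ S then 1 else 0 := by
  classical
  simp [indicatorVector, Finsupp.single_apply]

theorem indicatorVector_mem_coordSubspace_iff {S C : Set ι} :
    indicatorVector b S ∈ coordSubspace b C ↔ Disjoint S C := by
  classical
  simp only [coordSubspace, Set.mem_ofPred_eq, repr_indicatorVector, Set.disjoint_right]
  simp

theorem coordSubspace_subset_iff {C C' : Set ι} :
    coordSubspace b C ⊆ coordSubspace b C' ↔ C' ⊆ C := by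
  refine ⟨fun h => ?_, fun h v hv i hi => hv i (h hi)⟩
  have := h ((indicatorVector_mem_coordSubspace_iff b (S := Cᶜ)).2 disjoint_compl_left)
  rw [indicatorVector_mem_coordSubspace_iff] at this
  exact Set.disjoint_compl_left_iff_subset.1 this

variable [Infinite K]

theorem isClosed_coordSubspace (C : Set ι) : IsClosed[zariski K V] (coordSubspace b C) := by
  let _ := zariski K V
  refine closure_subset_iff_isClosed.1 fun u hu i hi => ?_
  have := (mem_closure_zariski_iff_eval b).1 hu (MvPolynomial.X i) fun y hy => by
    rw [MvPolynomial.eval_X]; exact hy i hi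
  simpa using this

/-- Points of two nonempty relatively open sets are joined by a line inside the subspace. On it the
two defining functions are nonzero polynomials in one variable, so over an infinite field they have
a common point of non-vanishing. -/
theorem isIrreducible_coordSubspace (C : Set ι) :
    @IsIrreducible V (zariski K V) (coordSubspace b C) := by
  let _ := zariski K V
  refine ⟨⟨0, fun i _ => by simp⟩, ?_⟩
  rintro U U' hU hU' ⟨x, hx, hxU⟩ ⟨y, hy, hyU⟩
  obtain ⟨_, ⟨f, hf, rfl⟩, hfx, hfU⟩ := isTopologicalBasis_zariski.exists_subset_of_mem_open hxU hU
  obtain ⟨_, ⟨g, hg, rfl⟩, hgy, hgU⟩ := isTopologicalBasis_zariski.exists_subset_of_mem_open hyU hU'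
  have key (f) (hf : f ∈ coordRing K V) :
      ∃ p : Polynomial K, ∀ s : K, p.eval s = f (x + s • (y - x)) := by
    refine ⟨MvPolynomial.aeval (fun i => Polynomial.C (b.repr x i) +
      Polynomial.X * Polynomial.C (b.repr (y - x) i)) ((polyEquiv b).symm ⟨f, hf⟩), fun s => ?_⟩
    have h1 := eval_polyEquiv_symm b ⟨f, hf⟩ (x + s • (y - x))
    change _ = f _ at h1
    rw [← h1, ← Polynomial.coe_evalRingHom, MvPolynomial.map_aeval, MvPolynomial.eval]
    congr 2
    · ext c; simp
    · ext i; simp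
  obtain ⟨p, hp⟩ := key f hf
  obtain ⟨q, hq⟩ := key g hg
  have hpq : p * q ≠ 0 := by
    refine mul_ne_zero ?_ ?_
    · rintro rfl
      have := hp 0
      rw [Polynomial.eval_zero, zero_smul, add_zero] at this
      exact hfx this.symm
    · rintro rfl
      have := hq 1
      rw [Polynomial.eval_zero, one_smul, add_sub_cancel] at this
      exact hgy this.symm
  obtain ⟨s, hs⟩ : ∃ s, (p * q).eval s ≠ 0 := by
    by_contra! h
    exact hpq (Polynomial.funext (by simpa using h))
  rw [Polynomial.eval_mul, hp, hq] at hs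
  refine ⟨x + s • (y - x), fun i hi => ?_, hfU (left_ne_zero_of_mul hs),
    hgU (right_ne_zero_of_mul hs)⟩
  simp [hx i hi, hy i hi]

include b in
/-- The coordinate ring is a domain. -/
theorem isDomain_coordRing : IsDomain (coordRing K V) :=
  (polyEquiv b).symm.toMulEquiv.isDomain _

include b in
theorem isNoetherianRing_coordRing : IsNoetherianRing (coordRing K V) :=
  isNoetherianRing_of_ringEquiv _ (polyEquiv b).toRingEquiv

omit [Fintype ι] [Infinite K] in
theorem X_dvd_iff_forall_coeff {p : MvPolynomial ι K} {k : ι} :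
    MvPolynomial.X k ∣ p ↔ ∀ m, p.coeff m ≠ 0 → m k ≠ 0 := by
  rw [MvPolynomial.X_dvd_iff_modMonomial_eq_zero]
  constructor
  · intro h m hm hmk
    have := MvPolynomial.coeff_modMonomial_of_not_le (s := Finsupp.single k 1) p (s' := m)
      (by rw [Finsupp.single_le_iff]; omega)
    rw [h, MvPolynomial.coeff_zero] at this
    exact hm this.symm
  · intro h
    ext m
    by_cases hmk : m k = 0
    · rw [MvPolynomial.coeff_modMonomial_of_not_le p (by rw [Finsupp.single_le_iff]; omega)]
      by_contra hne
      exact h m hne hmk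
    · rw [MvPolynomial.coeff_modMonomial_of_le p (by rw [Finsupp.single_le_iff]; omega)]
      simp

/-- The remainder modulo `X k` does not involve the `k`-th coordinate, so its value at any `v`
equals its value at the projection of `v` to the hyperplane. -/
theorem polyEquiv_mem_vanishingIdeal_iff {p : MvPolynomial ι K} {k : ι} :
    polyEquiv b p ∈ vanishingIdeal K V (coordSubspace b {k}) ↔ MvPolynomial.X k ∣ p := by
  classical
  constructor
  · intro h
    rw [MvPolynomial.X_dvd_iff_modMonomial_eq_zero]
    set q := p.modMonomial (Finsupp.single k 1) with hq
    have hqc (m : ι →₀ ℕ) (hm : q.coeff m ≠ 0) : m k = 0 := by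
      by_contra hmk
      rw [hq, MvPolynomial.coeff_modMonomial_of_le p (by rw [Finsupp.single_le_iff]; omega)] at hm
      exact hm rfl
    have hpq := MvPolynomial.divMonomial_add_modMonomial_single p k
    apply (polyEquiv b).injective
    ext v
    rw [polyEquiv_apply, map_zero]
    let v' := v - b.repr v k • b k
    have hv' (i) : b.repr v' i = if i = k then 0 else b.repr v i := by
      simp only [v', map_sub, map_smul, Finsupp.sub_apply, Finsupp.smul_apply,
        Module.Basis.repr_self, Finsupp.single_apply]
      by_cases hi : i = k
      · subst hi; simp
      · simp [hi, Ne.symm hi]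
    have h1 := h v' (by rintro i rfl; rw [hv', if_pos rfl])
    rw [polyEquiv_apply, ← hpq, map_add, map_mul, MvPolynomial.eval_X, hv', if_pos rfl, zero_mul,
      zero_add] at h1
    change _ = (0 : K)
    rw [← h1, MvPolynomial.eval_eq', MvPolynomial.eval_eq']
    refine Finset.sum_congr rfl fun m hm => ?_
    congr 1
    refine Finset.prod_congr rfl fun i _ => ?_
    by_cases hi : i = k
    · subst hi
      rw [hqc m (MvPolynomial.mem_support_iff.1 hm), pow_zero, pow_zero]
    · rw [hv', if_neg hi]
  · rintro ⟨q, rfl⟩ v hv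
    rw [polyEquiv_apply, map_mul, MvPolynomial.eval_X, hv k rfl, zero_mul]

theorem vanishingIdeal_coordSubspace_singleton (k : ι) :
    vanishingIdeal K V (coordSubspace b {k}) = Ideal.span {polyEquiv b (MvPolynomial.X k)} := by
  ext f
  obtain ⟨p, rfl⟩ := (polyEquiv b).surjective f
  rw [polyEquiv_mem_vanishingIdeal_iff, Ideal.mem_span_singleton]
  exact (map_dvd_iff (polyEquiv b)).symm

theorem prime_polyEquiv_X (k : ι) : Prime (polyEquiv b (MvPolynomial.X k)) :=
  (MulEquiv.prime_iff (polyEquiv b).toMulEquiv).2 MvPolynomial.X_prime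

theorem isPrime_vanishingIdeal_coordSubspace_singleton (k : ι) :
    (vanishingIdeal K V (coordSubspace b {k})).IsPrime := by
  rw [vanishingIdeal_coordSubspace_singleton,
    Ideal.span_singleton_prime (prime_polyEquiv_X b k).ne_zero]
  exact prime_polyEquiv_X b k

theorem isDivisorial_coordSubspace_singleton (k : ι) :
    IsDivisorial K V (coordSubspace b {k}) := by
  have := isDomain_coordRing b
  have := isNoetherianRing_coordRing b
  rw [IsDivisorial, vanishingIdeal_coordSubspace_singleton]
  exact Ideal.height_span_singleton_eq_one_of_mem_nonZeroDivisors
    (mem_nonZeroDivisors_of_ne_zero (prime_polyEquiv_X b k).ne_zero)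
    (prime_polyEquiv_X b k).not_isUnit

/-- A coordinate subspace of codimension one is a coordinate hyperplane. -/
theorem eq_singleton_of_isDivisorial_coordSubspace {C : Set ι} {k : ι} (hk : k ∈ C)
    (h : IsDivisorial K V (coordSubspace b C)) : C = {k} := by
  classical
  have := isDomain_coordRing b
  have := isPrime_vanishingIdeal_coordSubspace_singleton b k
  have hle : vanishingIdeal K V (coordSubspace b {k}) ≤ vanishingIdeal K V (coordSubspace b C) :=
    fun f hf v hv => hf v fun i hi => hv i (Set.mem_singleton_iff.1 hi ▸ hk)
  have heq : vanishingIdeal K V (coordSubspace b {k}) = vanishingIdeal K V (coordSubspace b C) := by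
    by_contra hne
    have hlt := lt_of_le_of_ne hle hne
    have h1 : (vanishingIdeal K V (coordSubspace b {k})).height = 1 :=
      isDivisorial_coordSubspace_singleton b k
    have : (vanishingIdeal K V (coordSubspace b {k})).FiniteHeight :=
      ⟨Or.inr (by rw [h1]; exact ENat.one_ne_top)⟩
    have h2 := Ideal.height_strict_mono_of_isPrime hlt
    rw [h1, show (vanishingIdeal K V (coordSubspace b C)).height = 1 from h] at h2
    exact lt_irrefl _ h2
  refine subset_antisymm (fun i hi => ?_) (Set.singleton_subset_iff.2 hk)
  have hmem : polyEquiv b (MvPolynomial.X i) ∈ vanishingIdeal K V (coordSubspace b {k}) := by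
    rw [heq]
    intro v hv
    rw [polyEquiv_apply, MvPolynomial.eval_X]
    exact hv i hi
  rw [polyEquiv_mem_vanishingIdeal_iff, MvPolynomial.X_dvd_X] at hmem
  exact hmem.symm

end CoordinateSubspaces

/-! ### Components of the strictly semistable locus -/

section Components

variable {K V ι : Type*} [Field K] [IsAlgClosed K] [AddCommGroup V] [Module K V] [Fintype ι] {r : ℕ}
  {ρ : Representation K (Torus K r) V} {b : Module.Basis ι K V} {a : ι → Fin r → ℤ}
  (hb : ∀ t i, ρ t (b i) = torusChar K (a i) t • b i)
include hb

/-- The indicator vector of `Cᶜ` has the largest support in the subspace, and stable supports are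
closed under enlargement, so it is stable as soon as any vector of the subspace is. -/
theorem coordSubspace_subset_sssLocus_iff {C : Set ι} :
    coordSubspace b C ⊆ sssLocus ρ ↔ ¬ IsStableSupport (weightMonoid a) Cᶜ := by
  classical
  constructor
  · intro h hst
    refine h ((indicatorVector_mem_coordSubspace_iff b (S := Cᶜ)).2 disjoint_compl_left) ?_
    rw [isStableVector_iff hb]
    convert! hst
    ext i
    rw [Set.mem_ofPred_eq, repr_indicatorVector]
    split_ifs with hi <;> simp [hi]
  · intro h v hv hst
    rw [isStableVector_iff hb] at hst
    exact h (hst.mono fun i hi hiC => hi (hv i hiC))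

theorem mem_sssLocus_iff {v : V} :
    v ∈ sssLocus ρ ↔ coordSubspace b {i | b.repr v i = 0} ⊆ sssLocus ρ := by
  rw [coordSubspace_subset_sssLocus_iff hb]
  exact (isStableVector_iff hb).not

theorem isStableSupport_univ (h : IsStable ρ) : IsStableSupport (weightMonoid a) Set.univ := by
  obtain ⟨v, hv⟩ := h
  exact ((isStableVector_iff hb).1 hv).mono (Set.subset_univ _)

/-- The locus is a union of finitely many closed coordinate subspaces, and an irreducible subset
lies in one of them. -/
theorem exists_subset_coordSubspace {Y : Set V} (hY : @IsIrreducible V (zariski K V) Y)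
    (hYs : Y ⊆ sssLocus ρ) : ∃ C, Y ⊆ coordSubspace b C ∧ coordSubspace b C ⊆ sssLocus ρ := by
  classical
  have := IsAlgClosed.instInfinite (K := K)
  let _ := zariski K V
  let T : Finset (Set V) := Set.Finite.toFinset
    (s := {W | ∃ C : Set ι, W = coordSubspace b C ∧ coordSubspace b C ⊆ sssLocus ρ})
    ((Set.finite_range (coordSubspace b)).subset (by rintro _ ⟨C, rfl, -⟩; exact ⟨C, rfl⟩))
  obtain ⟨W, hW, hYW⟩ := isIrreducible_iff_sUnion_isClosed.1 hY T (by
    intro W hW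
    rw [Set.Finite.mem_toFinset] at hW
    obtain ⟨C, rfl, -⟩ := hW
    exact isClosed_coordSubspace b C) (by
    intro v hv
    refine ⟨coordSubspace b {i | b.repr v i = 0}, ?_, fun i hi => hi⟩
    rw [Finset.mem_coe, Set.Finite.mem_toFinset]
    exact ⟨_, rfl, (mem_sssLocus_iff hb).1 (hYs hv)⟩)
  rw [Set.Finite.mem_toFinset] at hW
  obtain ⟨C, rfl, hC⟩ := hW
  exact ⟨C, hYW, hC⟩

theorem isComponent_coordSubspace {C : Set ι}
    (hC : Minimal (fun C => coordSubspace b C ⊆ sssLocus ρ) C) :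
    IsComponent K V (sssLocus ρ) (coordSubspace b C) := by
  have := IsAlgClosed.instInfinite (K := K)
  refine ⟨⟨isIrreducible_coordSubspace b C, hC.1⟩, fun Y hY hCY => ?_⟩
  obtain ⟨C', hYC', hC'⟩ := exists_subset_coordSubspace hb hY.1 hY.2
  have h1 : C' ⊆ C := (coordSubspace_subset_iff b).1 (hCY.trans hYC')
  exact hYC'.trans ((coordSubspace_subset_iff b).2 (hC.2 hC' h1))

theorem exists_eq_coordSubspace_of_isComponent {Z : Set V} (hZ : IsComponent K V (sssLocus ρ) Z) :
    ∃ C, Z = coordSubspace b C := by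
  have := IsAlgClosed.instInfinite (K := K)
  obtain ⟨C, hZC, hC⟩ := exists_subset_coordSubspace hb hZ.1.1 hZ.1.2
  exact ⟨C, hZC.antisymm (hZ.2 ⟨isIrreducible_coordSubspace b C, hC⟩ hZC)⟩

theorem exists_eq_coordSubspace_singleton_of_isComponent (hst : IsStable ρ) {Z : Set V}
    (hZ : IsComponent K V (sssLocus ρ) Z) (hdiv : IsDivisorial K V Z) :
    ∃ k, IsTied (weightMonoid a) k ∧ Z = coordSubspace b {k} := by
  have := IsAlgClosed.instInfinite (K := K)
  obtain ⟨C, rfl⟩ := exists_eq_coordSubspace_of_isComponent hb hZ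
  have huniv := isStableSupport_univ hb hst
  have hns := (coordSubspace_subset_sssLocus_iff hb).1 hZ.1.2
  obtain ⟨k, hk⟩ : C.Nonempty := by
    by_contra hne
    rw [Set.not_nonempty_iff_eq_empty] at hne
    rw [hne, Set.compl_empty] at hns
    exact hns huniv
  obtain rfl := eq_singleton_of_isDivisorial_coordSubspace b hk hdiv
  exact ⟨k, isTied_of_not_isStableSupport huniv hns, rfl⟩

theorem isComponent_coordSubspace_singleton (hst : IsStable ρ) {k : ι}
    (hk : IsTied (weightMonoid a) k) : IsComponent K V (sssLocus ρ) (coordSubspace b {k}) := by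
  refine isComponent_coordSubspace hb ⟨(coordSubspace_subset_sssLocus_iff hb).2
    (not_isStableSupport_of_isTied hk), fun C hC hCk => ?_⟩
  rcases Set.subset_singleton_iff_eq.1 hCk with rfl | rfl
  · rw [coordSubspace_subset_sssLocus_iff hb, Set.compl_empty] at hC
    exact absurd (isStableSupport_univ hb hst) hC
  · exact le_rfl

/-- Otherwise the subspace where all untied coordinates vanish lies in `V^sss`, hence in a component
cut out by untied coordinates only. By purity that component is a hyperplane of a tied coordinate.
-/
theorem isStableSupport_isTied_of_isPure (h : IsPure ρ) :
    IsStableSupport (weightMonoid a) {k | IsTied (weightMonoid a) k} := by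
  have := IsAlgClosed.instInfinite (K := K)
  by_contra hns
  have hC₀ : coordSubspace b {k | IsTied (weightMonoid a) k}ᶜ ⊆ sssLocus ρ := by
    rwa [coordSubspace_subset_sssLocus_iff hb, compl_compl]
  obtain ⟨C, hCC₀, hC⟩ := exists_minimal_le_of_wellFoundedLT
    (fun C => coordSubspace b C ⊆ sssLocus ρ) _ hC₀
  have hcomp := isComponent_coordSubspace hb hC
  obtain ⟨k, hk, hCk⟩ := exists_eq_coordSubspace_singleton_of_isComponent hb h.1 hcomp
    (h.2 _ hcomp)
  have h1 : {k} ⊆ C := (coordSubspace_subset_iff b).1 hCk.subset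
  exact hCC₀ (h1 rfl) hk

end Components

/-- In the localization of a domain at a prime of height one, some power of every non-unit is
divisible by a given nonzero element. -/
theorem exists_mul_pow_eq_mul_of_height_eq_one {R : Type*} [CommRing R] [IsDomain R] {p : Ideal R}
    (hprime : p.IsPrime) (hp : p.height = 1) {x x' : R} (hx0 : x ≠ 0) (hx' : x' ∈ p) :
    ∃ s ∉ p, ∃ N : ℕ, ∃ g, s * x' ^ N = x * g := by
  -- If the multiplicative set generated by `x'` and the complement of `p` missed `(x)`, a prime
  -- containing `x` would lie strictly inside `p`. Height one makes that prime zero.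
  have hdis : ¬ Disjoint (Ideal.span {x} : Set R)
      (p.primeCompl ⊔ Submonoid.powers x' : Submonoid R) := by
    intro hdis
    obtain ⟨q, hq, hxq, hqd⟩ := Ideal.exists_le_prime_disjoint _ _ hdis
    have hqp : q ≤ p := fun y hy => by
      by_contra hyp
      exact Set.disjoint_left.1 hqd hy (Submonoid.mem_sup_left hyp)
    have hne : q ≠ p := by
      rintro rfl
      exact Set.disjoint_left.1 hqd hx' (Submonoid.mem_sup_right (Submonoid.mem_powers x'))
    have : p.FiniteHeight := ⟨Or.inr (by rw [hp]; exact ENat.one_ne_top)⟩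
    have : q.FiniteHeight := Ideal.finiteHeight_of_le hqp hprime.ne_top
    have h1 := Ideal.height_strict_mono_of_isPrime (lt_of_le_of_ne hqp hne)
    rw [hp, Order.lt_one_iff, Ideal.height_eq_zero_iff_eq_bot] at h1
    have : x ∈ q := hxq (Ideal.mem_span_singleton_self x)
    rw [h1] at this
    exact hx0 this
  rw [Set.not_disjoint_iff] at hdis
  obtain ⟨y, hy, hyS⟩ := hdis
  obtain ⟨s, hs, z, ⟨N, rfl⟩, rfl⟩ := Submonoid.mem_sup.1 hyS
  obtain ⟨g, hg⟩ := Ideal.mem_span_singleton.1 hy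
  exact ⟨s, hs, N, g, hg⟩

/-! ### Image ideals of coordinate hyperplanes -/

section InvariantRing

variable {K V ι : Type*} [Field K] [Infinite K] [AddCommGroup V] [Module K V] [Fintype ι] {r : ℕ}
  {ρ : Representation K (Torus K r) V} {a : ι → Fin r → ℤ}

variable (ρ) in
/-- An invariant as a polynomial in the coordinates. -/
def toPoly (b : Module.Basis ι K V) : invariants ρ →ₐ[K] MvPolynomial ι K :=
  (polyEquiv b).symm.toAlgHom.comp (invariants ρ).val

variable {b : Module.Basis ι K V}

theorem polyEquiv_toPoly (f : invariants ρ) : polyEquiv b (toPoly ρ b f) = f.1 :=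
  (polyEquiv b).apply_symm_apply _

theorem toPoly_injective : Function.Injective (toPoly ρ b) :=
  (polyEquiv b).symm.injective.comp Subtype.val_injective

theorem mem_imageIdeal_iff {k : ι} {f : invariants ρ} :
    f ∈ imageIdeal ρ (coordSubspace b {k}) ↔ ∀ m, (toPoly ρ b f).coeff m ≠ 0 → m k ≠ 0 := by
  rw [← X_dvd_iff_forall_coeff, ← polyEquiv_mem_vanishingIdeal_iff b, polyEquiv_toPoly]
  rfl

theorem isDomain_invariants (b : Module.Basis ι K V) : IsDomain (invariants ρ) :=
  toPoly_injective (b := b).isDomain (toPoly ρ b).toRingHom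

variable (hb : ∀ t i, ρ t (b i) = torusChar K (a i) t • b i)
include hb

theorem mem_weightMonoid_of_coeff_toPoly {f : invariants ρ} {m : ι →₀ ℕ}
    (hm : (toPoly ρ b f).coeff m ≠ 0) : m ∈ weightMonoid a :=
  (polyEquiv_mem_invariants_iff hb _).1 (polyEquiv_toPoly (b := b) f ▸ f.2) m hm

theorem exists_toPoly_eq {p : MvPolynomial ι K} (hp : ∀ m, p.coeff m ≠ 0 → m ∈ weightMonoid a) :
    ∃ f : invariants ρ, toPoly ρ b f = p :=
  ⟨⟨polyEquiv b p, (polyEquiv_mem_invariants_iff hb p).2 hp⟩, (polyEquiv b).symm_apply_apply p⟩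

omit [Infinite K] [Fintype ι] hb in
theorem eq_of_coeff_monomial_ne_zero {m m' : ι →₀ ℕ}
    (h : (MvPolynomial.monomial m (1 : K)).coeff m' ≠ 0) : m' = m := by
  classical
  rw [MvPolynomial.coeff_monomial] at h
  by_contra hne
  exact h (if_neg (Ne.symm hne))

/-- An invariant monomial. -/
def invMonomial (m : weightMonoid a) : invariants ρ :=
  ⟨polyEquiv b (MvPolynomial.monomial m.1 1), (polyEquiv_mem_invariants_iff hb _).2 fun _ h =>
    eq_of_coeff_monomial_ne_zero h ▸ m.2⟩

theorem toPoly_invMonomial (m : weightMonoid a) :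
    toPoly ρ b (invMonomial hb m) = MvPolynomial.monomial m.1 1 :=
  (polyEquiv b).symm_apply_apply _

theorem invMonomial_nsmul (n : ℕ) (m : weightMonoid a) :
    invMonomial hb (n • m) = invMonomial hb m ^ n := by
  apply toPoly_injective (b := b)
  simp [toPoly_invMonomial, MvPolynomial.monomial_pow]

theorem invMonomial_mem_imageIdeal_iff {k : ι} {m : weightMonoid a} :
    invMonomial hb m ∈ imageIdeal ρ (coordSubspace b {k}) ↔ m.1 k ≠ 0 := by
  rw [mem_imageIdeal_iff, toPoly_invMonomial]
  refine ⟨fun h => h _ (by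
    classical rw [MvPolynomial.coeff_monomial, if_pos rfl]; exact one_ne_zero), fun h m' hm' => ?_⟩
  rwa [eq_of_coeff_monomial_ne_zero hm']

/-- A hyperplane whose image is a prime divisor gives an archimedean face. -/
theorem isArchimedeanAt_of_mapsToDivisor {k : ι} (h : MapsToDivisor ρ (coordSubspace b {k})) :
    IsArchimedeanAt (weightMonoid a) k := by
  intro m hm m' hm' hk
  by_cases hmk : m k = 0
  · exact ⟨0, m, hm, hmk, by simp⟩
  have := isDomain_invariants (ρ := ρ) b
  set p := imageIdeal ρ (coordSubspace b {k}) with hp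
  have hprime : p.IsPrime := h.1
  let x := invMonomial hb ⟨m, hm⟩
  let x' := invMonomial hb ⟨m', hm'⟩
  have hx' : x' ∈ p := (invMonomial_mem_imageIdeal_iff hb).2 hk
  have hx0 : x ≠ 0 := by
    intro h0
    have := congrArg (toPoly ρ b) h0
    rw [toPoly_invMonomial, map_zero, MvPolynomial.monomial_eq_zero] at this
    exact one_ne_zero this
  obtain ⟨s, hsp, N, g, hg⟩ := exists_mul_pow_eq_mul_of_height_eq_one hprime h.2 hx0 hx'
  rw [mem_imageIdeal_iff (b := b)] at hsp
  push Not at hsp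
  obtain ⟨f, hf, hfk⟩ := hsp
  refine ⟨N, f, mem_weightMonoid_of_coeff_toPoly hb hf, hfk, ?_⟩
  -- The exponent `f + N • m'` occurs in `s * x' ^ N`, whereas every exponent of `x * g` is at least
  -- `m`.
  by_contra hle
  have hg' := congrArg (fun w => (toPoly ρ b w).coeff (f + N • m')) hg
  simp only [x, x', ← invMonomial_nsmul, map_mul, toPoly_invMonomial] at hg'
  rw [MvPolynomial.coeff_monomial_mul', if_neg hle] at hg'
  have h2 := MvPolynomial.coeff_mul_monomial f (N • m') (1 : K) (toPoly ρ b s)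
  rw [mul_one] at h2
  exact hf (h2.symm.trans hg')

/-- Every monomial of an element of the ideal is divisible by the monomial of `c`, and the quotient
is again invariant because `M` is closed under subtraction. -/
theorem imageIdeal_eq_span_of_isLeastAt {k : ι} {c : ι →₀ ℕ} (hc : IsLeastAt (weightMonoid a) k c) :
    imageIdeal ρ (coordSubspace b {k}) = Ideal.span {invMonomial hb ⟨c, hc.1⟩} := by
  refine le_antisymm (fun f hf => ?_) ?_
  · rw [mem_imageIdeal_iff (b := b)] at hf
    have hdvd : MvPolynomial.monomial c (1 : K) ∣ toPoly ρ b f := by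
      rw [MvPolynomial.monomial_one_dvd_iff_modMonomial_eq_zero]
      ext m
      by_cases hcm : c ≤ m
      · rw [MvPolynomial.coeff_modMonomial_of_le _ hcm, MvPolynomial.coeff_zero]
      · rw [MvPolynomial.coeff_modMonomial_of_not_le _ hcm, MvPolynomial.coeff_zero]
        by_contra hne
        exact hcm (hc.2.2 m (mem_weightMonoid_of_coeff_toPoly hb hne) (hf m hne))
    obtain ⟨q, hq⟩ := hdvd
    obtain ⟨g, hg⟩ := exists_toPoly_eq hb (p := q) fun m hm => by
      have h1 := MvPolynomial.coeff_monomial_mul m c (1 : K) q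
      rw [← hq, one_mul] at h1
      exact weightMonoid_sub a c hc.1 m (mem_weightMonoid_of_coeff_toPoly hb (h1 ▸ hm))
    refine Ideal.mem_span_singleton.2 ⟨g, toPoly_injective (b := b) ?_⟩
    rw [map_mul, toPoly_invMonomial, hg, hq]
  · rw [Ideal.span_singleton_le_iff_mem, invMonomial_mem_imageIdeal_iff]
    exact hc.2.1

end InvariantRing

/-! ### Divisors of monomials in power series rings -/

section PowerSeriesDivisibility

variable {K ι : Type*} [Field K]

variable (K) in
theorem prime_X_mvPowerSeries (k : ι) : Prime (MvPowerSeries.X k : MvPowerSeries ι K) := by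
  classical
  refine ⟨fun h0 => ?_, fun hu => ?_, fun p q hpq => ?_⟩
  · have := congrArg (MvPowerSeries.coeff (Finsupp.single k 1)) h0
    rw [MvPowerSeries.coeff_index_single_self_X, map_zero] at this
    exact one_ne_zero this
  · rw [MvPowerSeries.isUnit_iff_constantCoeff, MvPowerSeries.constantCoeff_X] at hu
    exact not_isUnit_zero hu
  -- `z f` keeps the monomials free of `x_k`, so `f` and `z f` are congruent modulo `X k`. A product
  -- of two such truncations is free of `x_k`, so it is divisible by `X k` only if it is zero.
  let z (f : MvPowerSeries ι K) : MvPowerSeries ι K :=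
    fun m => if m k = 0 then MvPowerSeries.coeff m f else 0
  have hz (f : MvPowerSeries ι K) (m) :
    MvPowerSeries.coeff m (z f) = if m k = 0 then MvPowerSeries.coeff m f else 0 := rfl
  have hsub (f : MvPowerSeries ι K) : MvPowerSeries.X k ∣ f - z f := by
    rw [MvPowerSeries.X_dvd_iff]
    intro m hm
    rw [map_sub, hz, if_pos hm, sub_self]
  have hdvd : MvPowerSeries.X k ∣ z p * z q := by
    have h1 := (hpq.sub ((hsub p).mul_right q)).sub ((hsub q).mul_left (z p))
    convert h1 using 1
    ring
  have h0 : z p * z q = 0 := by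
    ext m
    rw [map_zero]
    by_cases hm : m k = 0
    · exact MvPowerSeries.X_dvd_iff.1 hdvd m hm
    rw [MvPowerSeries.coeff_mul]
    refine Finset.sum_eq_zero fun x hx => ?_
    rw [hz, hz]
    have hxk : x.1 k + x.2 k = m k := by
      rw [← Finsupp.add_apply, Finset.HasAntidiagonal.mem_antidiagonal.1 hx]
    by_cases hx1 : x.1 k = 0
    · rw [if_neg (show ¬ x.2 k = 0 by omega), mul_zero]
    · rw [if_neg hx1, zero_mul]
  rcases mul_eq_zero.1 h0 with h | h
  · exact Or.inl (by simpa [h] using hsub p)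
  · exact Or.inr (by simpa [h] using hsub q)

/-- A divisor of a monomial in a power series ring is a monomial up to a unit. -/
theorem exists_associated_monomial_of_dvd {e : ι →₀ ℕ} {g : MvPowerSeries ι K}
    (h : g ∣ MvPowerSeries.monomial e 1) :
    ∃ u, Associated (MvPowerSeries.monomial u (1 : K)) g := by
  obtain ⟨q, hq⟩ := h
  induction hd : e.degree generalizing e g q with
  | zero =>
    refine ⟨0, ?_⟩
    rw [(Finsupp.degree_eq_zero_iff e).1 hd] at hq
    rw [MvPowerSeries.monomial_zero_one] at hq ⊢
    exact associated_one_iff_isUnit.2 (IsUnit.of_mul_eq_one _ hq.symm) |>.symm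
  | succ d ih =>
    obtain ⟨k, hk⟩ : ∃ k, e k ≠ 0 := by
      by_contra! h0
      have : e = 0 := Finsupp.ext h0
      rw [this, map_zero] at hd
      omega
    obtain ⟨e', rfl⟩ := exists_add_of_le (a := Finsupp.single k 1) (b := e)
      (by rw [Finsupp.single_le_iff]; omega)
    have hX := prime_X_mvPowerSeries K k
    have hmon (u : ι →₀ ℕ) : MvPowerSeries.monomial (Finsupp.single k 1 + u) (1 : K) =
        MvPowerSeries.X k * MvPowerSeries.monomial u 1 := by
      rw [MvPowerSeries.X, MvPowerSeries.monomial_mul_monomial, one_mul]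
    rw [hmon] at hq
    have hd' : e'.degree = d := by
      rw [map_add, Finsupp.degree_single] at hd; omega
    -- A prime `X k` of the monomial divides either `g` or its cofactor; cancel it there and lower
    -- the degree.
    rcases hX.dvd_or_dvd (hq ▸ dvd_mul_right _ _ : MvPowerSeries.X k ∣ g * q) with ⟨g', rfl⟩ | ⟨q', rfl⟩
    · rw [mul_assoc] at hq
      obtain ⟨u, hu⟩ := ih _ (mul_left_cancel₀ hX.ne_zero hq) hd'
      exact ⟨Finsupp.single k 1 + u, hmon u ▸ hu.mul_left _⟩
    · rw [mul_left_comm] at hq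
      exact ih _ (mul_left_cancel₀ hX.ne_zero hq) hd'

theorem le_of_monomial_dvd_monomial {u e : ι →₀ ℕ}
    (h : (MvPowerSeries.monomial u (1 : K)) ∣ MvPowerSeries.monomial e 1) : u ≤ e := by
  classical
  obtain ⟨q, hq⟩ := h
  by_contra hle
  have := congrArg (MvPowerSeries.coeff e) hq
  rw [MvPowerSeries.coeff_monomial_same, MvPowerSeries.coeff_monomial_mul, if_neg hle] at this
  exact one_ne_zero this

/-- A series that is set-theoretically a defining equation of the face ideal at `k` has a leading
monomial with the same property. -/
theorem exists_mem_of_forall_dvd_monomial {M : AddSubmonoid (ι →₀ ℕ)} {k : ι}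
    {g : MvPowerSeries ι K} (hg : ∀ m, MvPowerSeries.coeff m g ≠ 0 → m ∈ M ∧ m k ≠ 0)
    (hdvd : ∀ m ∈ M, m k ≠ 0 → ∃ N : ℕ, g ∣ MvPowerSeries.monomial (N • m) 1)
    (hne : ∃ m ∈ M, m k ≠ 0) :
    ∃ u ∈ M, u k ≠ 0 ∧ ∀ m ∈ M, m k ≠ 0 → ∃ N : ℕ, u ≤ N • m := by
  classical
  obtain ⟨m₁, hm₁, hm₁k⟩ := hne
  obtain ⟨N₁, hN₁⟩ := hdvd m₁ hm₁ hm₁k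
  obtain ⟨u, hu⟩ := exists_associated_monomial_of_dvd hN₁
  -- As `g` is a unit times the monomial `u`, the exponent `u` occurs in `g`, and therefore lies in
  -- `M` with positive `k`-th coordinate.
  have huc : MvPowerSeries.coeff u g ≠ 0 := by
    obtain ⟨w, hw⟩ := hu
    have h1 := MvPowerSeries.coeff_monomial_mul u u (w : MvPowerSeries ι K) (1 : K)
    rw [if_pos le_rfl, hw, one_mul, tsub_self] at h1
    rw [h1]
    exact (MvPowerSeries.isUnit_iff_constantCoeff.1 w.isUnit).ne_zero
  refine ⟨u, (hg u huc).1, (hg u huc).2, fun m hm hmk => ?_⟩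
  obtain ⟨N, hN⟩ := hdvd m hm hmk
  exact ⟨N, le_of_monomial_dvd_monomial (hu.dvd.trans hN)⟩

end PowerSeriesDivisibility

/-! ### Symbolic powers and local equations of divisors -/

section Symbolic

variable {A : Type*} [CommRing A] {P : Ideal A} [P.IsPrime]

theorem mem_symbolicPower {n : ℕ} {f : A} : f ∈ symbolicPower P n ↔ ∃ s ∉ P, s * f ∈ P ^ n := by
  rw [symbolicPower, Ideal.mem_comap,
    IsLocalization.algebraMap_mem_map_algebraMap_iff P.primeCompl]
  rfl

theorem symbolicPower_zero : symbolicPower P 0 = ⊤ := by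
  rw [symbolicPower, pow_zero, Ideal.one_eq_top, Ideal.map_top, Ideal.comap_top]

theorem symbolicPower_one : symbolicPower P 1 = P := by
  ext f
  rw [mem_symbolicPower, pow_one]
  refine ⟨fun ⟨s, hs, h⟩ => ((‹P.IsPrime›).mem_or_mem h).resolve_left hs, fun h =>
    ⟨1, fun h1 => (‹P.IsPrime›).ne_top ((Ideal.eq_top_iff_one _).2 h1), by rwa [one_mul]⟩⟩

theorem pow_le_symbolicPower (n : ℕ) : P ^ n ≤ symbolicPower P n :=
  Ideal.le_comap_map

theorem symbolicPower_le {n : ℕ} (hn : n ≠ 0) : symbolicPower P n ≤ P := fun f hf => by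
  obtain ⟨s, hs, h⟩ := mem_symbolicPower.1 hf
  exact ((‹P.IsPrime›).mem_or_mem (Ideal.pow_le_self hn h)).resolve_left hs

omit [P.IsPrime] in
theorem ideal_single (P : PrimeDivisor A) (n : ℕ) :
    EffectiveDivisor.ideal (Finsupp.single P n) = haveI := P.2.1; symbolicPower P.1 n := by
  classical
  have := P.2.1
  refine le_antisymm ((iInf_le _ P).trans (by rw [Finsupp.single_eq_same])) (le_iInf fun Q => ?_)
  have := Q.2.1
  by_cases hQ : Q = P
  · subst hQ; rw [Finsupp.single_eq_same]
  · rw [Finsupp.single_eq_of_ne hQ, symbolicPower_zero]; exact le_top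

/-- A generator of the stalk of an ideal can be chosen in the ideal. -/
theorem exists_mem_forall_dvd_mul_of_isPrincipal_map {p I : Ideal A} [p.IsPrime]
    (h : Submodule.IsPrincipal (I.map (algebraMap A (Localization.AtPrime p)))) :
    ∃ g ∈ I, ∀ f ∈ I, ∃ s ∉ p, g ∣ s * f := by
  obtain ⟨γ, hγ⟩ := h.principal
  have hγI : γ ∈ I.map (algebraMap A (Localization.AtPrime p)) := by
    rw [hγ]; exact Submodule.mem_span_singleton_self γ
  obtain ⟨⟨g, s⟩, hgs⟩ := (IsLocalization.mem_map_algebraMap_iff p.primeCompl _).1 hγI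
  refine ⟨g, g.2, fun f hf => ?_⟩
  have hfI : algebraMap A (Localization.AtPrime p) f ∈ Ideal.span {γ} := by
    have := Ideal.mem_map_of_mem (algebraMap A (Localization.AtPrime p)) hf
    rw [hγ] at this
    exact this
  obtain ⟨δ, hδ⟩ := Ideal.mem_span_singleton.1 hfI
  obtain ⟨⟨y, t⟩, hyt⟩ := IsLocalization.surj p.primeCompl δ
  have h1 : algebraMap A (Localization.AtPrime p) (s * t * f) =
      algebraMap A (Localization.AtPrime p) (g * y) := by
    simp only [map_mul, hδ, ← hyt, ← hgs]
    ring
  obtain ⟨c, hc⟩ := (IsLocalization.eq_iff_exists p.primeCompl _).1 h1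
  refine ⟨c * (s * t), (c * (s * t)).2, c * y, ?_⟩
  rw [mul_assoc, hc]
  ring

-- A local equation of `nP` lies in `P` because `n > 0`, and it divides the `n`-th powers of
-- elements of `P`, since the ordinary power is contained in the symbolic one.
omit [P.IsPrime] in
theorem exists_mem_forall_dvd_mul_pow_of_isQCartier {P : PrimeDivisor A}
    (h : EffectiveDivisor.IsQCartier (Finsupp.single P 1)) (p : Ideal A) [p.IsPrime] :
    ∃ n : ℕ, ∃ g ∈ P.1, ∀ f ∈ P.1, ∃ s ∉ p, g ∣ s * f ^ n := by
  have := P.2.1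
  obtain ⟨n, hn, hC⟩ := h
  have hC := hC p
  rw [Finsupp.smul_single, smul_eq_mul, mul_one, ideal_single] at hC
  obtain ⟨g, hg, hdvd⟩ := exists_mem_forall_dvd_mul_of_isPrincipal_map hC
  exact ⟨n, g, symbolicPower_le hn.ne' hg, fun f hf =>
    hdvd _ (pow_le_symbolicPower n (Ideal.pow_mem_pow hf n))⟩

end Symbolic

/-! ### Monomial equations from the `ℚ`-Cartier property -/

section QCartier

variable {K V ι : Type*} [Field K] [Infinite K] [AddCommGroup V] [Module K V] [Fintype ι] {r : ℕ}
  {ρ : Representation K (Torus K r) V} {a : ι → Fin r → ℤ} {b : Module.Basis ι K V}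

omit [Infinite K] in
theorem ideal_imageDivisor {Z : Set V} (h : MapsToDivisor ρ Z) :
    EffectiveDivisor.ideal (imageDivisor h) = imageIdeal ρ Z := by
  have := h.1
  exact (ideal_single (⟨_, h⟩ : PrimeDivisor (invariants ρ)) 1).trans symbolicPower_one

theorem isQCartier_of_isCartier {A : Type*} [CommRing A] {D : EffectiveDivisor A}
    (h : D.IsCartier) : D.IsQCartier :=
  ⟨1, one_pos, by rwa [one_smul]⟩

theorem isCartier_of_isPrincipal {A : Type*} [CommRing A] {D : EffectiveDivisor A}
    (h : D.IsPrincipal) : D.IsCartier := fun p _ => by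
  obtain ⟨g, hg⟩ := h.principal
  refine ⟨⟨algebraMap _ _ g, ?_⟩⟩
  rw [hg, ← Ideal.span, Ideal.map_span, Set.image_singleton, ← Ideal.span]

variable (ρ b) in
/-- The ideal of the image of the origin in the quotient. -/
def originIdeal : Ideal (invariants ρ) :=
  RingHom.ker ((MvPolynomial.constantCoeff (R := K)).comp (toPoly ρ b).toRingHom)

theorem mem_originIdeal {f : invariants ρ} :
    f ∈ originIdeal ρ b ↔ MvPolynomial.constantCoeff (toPoly ρ b f) = 0 := Iff.rfl

instance isMaximal_originIdeal : (originIdeal ρ b).IsMaximal := by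
  refine RingHom.ker_isMaximal_of_surjective _ fun c =>
    ⟨algebraMap K (invariants ρ) c, ?_⟩
  change MvPolynomial.constantCoeff (toPoly ρ b (algebraMap K (invariants ρ) c)) = c
  rw [AlgHom.commutes, MvPolynomial.algebraMap_eq, MvPolynomial.constantCoeff_C]

variable (hb : ∀ t i, ρ t (b i) = torusChar K (a i) t • b i)
include hb

/-- Take a local equation of a multiple of the divisor at the image of the origin. The denominators
do not vanish at the origin, so they become units among power series, and the equation divides a
power of each monomial of the image ideal there. -/
theorem exists_mem_of_isQCartier {k : ι} (h : MapsToDivisor ρ (coordSubspace b {k}))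
    (hQ : EffectiveDivisor.IsQCartier (imageDivisor h)) (hne : ∃ m ∈ weightMonoid a, m k ≠ 0) :
    ∃ u ∈ weightMonoid a, u k ≠ 0 ∧ ∀ m ∈ weightMonoid a, m k ≠ 0 → ∃ N : ℕ, u ≤ N • m := by
  obtain ⟨n, g, hg, hdvd⟩ := exists_mem_forall_dvd_mul_pow_of_isQCartier
    (P := (⟨_, h⟩ : PrimeDivisor (invariants ρ))) hQ (originIdeal ρ b)
  have hgk := mem_imageIdeal_iff.1 hg
  refine exists_mem_of_forall_dvd_monomial (K := K) (g := (toPoly ρ b g : MvPowerSeries ι K))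
    (fun m hm => ?_) (fun m hm hmk => ⟨n, ?_⟩) hne
  · rw [MvPolynomial.coeff_coe] at hm
    exact ⟨mem_weightMonoid_of_coeff_toPoly hb hm, hgk m hm⟩
  · obtain ⟨s, hs, y, hy⟩ := hdvd (invMonomial hb ⟨m, hm⟩)
      ((invMonomial_mem_imageIdeal_iff hb).2 hmk)
    rw [← invMonomial_nsmul] at hy
    have hy' := congrArg (fun f => (toPoly ρ b f : MvPowerSeries ι K)) hy
    simp only [map_mul, toPoly_invMonomial, MvPolynomial.coe_mul, MvPolynomial.coe_monomial] at hy'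
    have hu : IsUnit (toPoly ρ b s : MvPowerSeries ι K) := by
      rw [MvPowerSeries.isUnit_iff_constantCoeff, isUnit_iff_ne_zero]
      intro h0
      refine hs (mem_originIdeal.2 ?_)
      rw [← h0, ← MvPowerSeries.coeff_zero_eq_constantCoeff_apply, MvPolynomial.coeff_coe,
        MvPolynomial.constantCoeff_eq]
    exact (hu.dvd_mul_left).1 ⟨_, hy'⟩

end QCartier

/-! ### Prime ideals in invariants of a finite group on a factorial ring -/

section FiniteGroup

/-- In the ring of invariants of a finite group acting on a factorial domain, a prime ideal such
that all members of `X` are associated up to powers at it is defined up to powers by one element. -/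
theorem exists_mem_forall_dvd_pow_of_finite_group {R B G : Type*} [CommRing R] [CommRing B]
    [IsDomain B] [UniqueFactorizationMonoid B] [Group G] [Finite G] [MulSemiringAction G B]
    (φ : R →+* B) (hφ : Function.Injective φ) (hinv : ∀ c, (∀ g : G, g • c = c) ↔ ∃ x, φ x = c)
    {p : Ideal R} (hp : p.IsPrime) {X : Set R} (hX : X ⊆ p) (hX0 : 0 ∉ X)
    (harch : ∀ x ∈ X, ∀ x' ∈ X, ∃ s ∉ p, ∃ N : ℕ, x ∣ s * x' ^ N) :
    ∃ g ∈ p, ∀ x ∈ X, ∃ N : ℕ, g ∣ x ^ N := by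
  classical
  rcases X.eq_empty_or_nonempty with rfl | ⟨x₀, hx₀⟩
  · exact ⟨0, p.zero_mem, by simp⟩
  have := Fintype.ofFinite G
  let := φ.toAlgebra
  have : Algebra.IsInvariant R B G := ⟨fun c hc => (hinv c).1 hc⟩
  have := Algebra.IsInvariant.isIntegral R B G
  have hker : RingHom.ker (algebraMap R B) ≤ p := by
    exact ((RingHom.injective_iff_ker_eq_bot φ).1 hφ).le.trans bot_le
  -- `B` is integral over the invariants, so a prime lies over `p`; one of the prime factors `f` of
  -- `φ x₀` belongs to it.
  obtain ⟨q, hq, hqp⟩ := Ideal.exists_ideal_over_prime_of_isIntegral_of_isDomain (S := B) p hker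
  have hmem (x : R) : φ x ∈ q ↔ x ∈ p := by rw [← hqp]; rfl
  have hne {x : R} (hx : x ∈ X) : φ x ≠ 0 := fun h =>
    hX0 (by rwa [← (map_eq_zero_iff φ hφ).1 h])
  obtain ⟨F, hF, u, hu⟩ := UniqueFactorizationMonoid.exists_prime_factors _ (hne hx₀)
  have hFq : F.prod ∈ q := by
    refine (hq.mem_or_mem (hu ▸ (hmem x₀).2 (hX hx₀))).resolve_right fun h => ?_
    exact hq.ne_top (Ideal.eq_top_of_isUnit_mem _ h u.isUnit)
  obtain ⟨f, hfF, hfq⟩ := (hq.multiset_prod_mem_iff_exists_mem F).1 hFq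
  have hf := hF f hfF
  have hfx₀ : f ∣ φ x₀ := hu ▸ (Multiset.dvd_prod hfF).mul_right _
  -- `f` divides `φ s * φ x ^ N` but not `φ s`, since `s ∉ p`. So this one prime divides every
  -- element of `X`.
  have hdvd {x : R} (hx : x ∈ X) : f ∣ φ x := by
    obtain ⟨s, hs, N, hN⟩ := harch x₀ hx₀ x hx
    have h1 : f ∣ φ s * φ x ^ N := by
      rw [← map_pow, ← map_mul]
      exact hfx₀.trans (map_dvd φ hN)
    rcases hf.dvd_or_dvd h1 with h | h
    · exact absurd ((hmem s).1 (q.mem_of_dvd h hfq)) hs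
    · exact hf.dvd_of_dvd_pow h
  -- The norm of `f` is invariant. Each conjugate of `f` divides the invariant `φ x`, so the norm
  -- divides its power with exponent the group order, and the cofactor is invariant by cancellation.
  obtain ⟨g, hg⟩ := (hinv (∏ h : G, h • f)).1 (Finset.smul_prod_perm f)
  have hfg : f ∣ φ g := by
    rw [hg]
    simpa using Finset.dvd_prod_of_mem (fun h : G => h • f) (Finset.mem_univ 1)
  refine ⟨g, (hmem g).1 (q.mem_of_dvd hfg hfq), fun x hx => ⟨Fintype.card G, ?_⟩⟩
  have hfix (h : G) : h • φ x = φ x := (hinv (φ x)).2 ⟨x, rfl⟩ h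
  have h1 : φ g ∣ φ x ^ Fintype.card G := by
    rw [hg, ← Finset.card_univ, ← Finset.prod_const]
    refine Finset.prod_dvd_prod_of_dvd _ _ fun h _ => ?_
    rw [← hfix h]
    exact map_dvd (MulSemiringAction.toRingHom G B h) (hdvd hx)
  obtain ⟨c, hc⟩ := h1
  have hg0 : φ g ≠ 0 := by
    intro h0
    rw [h0, zero_mul] at hc
    exact hne hx (pow_eq_zero_iff Fintype.card_ne_zero |>.1 hc)
  obtain ⟨d, rfl⟩ := (hinv c).1 fun h => by
    refine mul_left_cancel₀ hg0 ?_
    have h2 := congrArg (h • ·) hc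
    simp only [smul_mul', smul_pow', hfix] at h2
    rw [(hinv (φ g)).2 ⟨g, rfl⟩ h] at h2
    exact h2.symm.trans hc
  exact ⟨d, hφ (by rw [map_mul, map_pow, hc])⟩

end FiniteGroup

/-! ### From the completion of the invariant ring to power series -/

section Completion

variable {K ι : Type*} [Field K]

theorem le_order_of_mem_span_X_pow {n : ℕ} {f : MvPowerSeries ι K}
    (hf : f ∈ Ideal.span (Set.range (MvPowerSeries.X : ι → MvPowerSeries ι K)) ^ n) :
    n ≤ f.order := by
  induction n generalizing f with
  | zero => simp
  | succ n ih =>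
    rw [pow_succ] at hf
    refine Submodule.mul_induction_on hf (fun g hg h hh => ?_) fun g h hg hh =>
      (le_min hg hh).trans MvPowerSeries.min_order_le_add
    have h1 : 1 ≤ h.order := by
      rw [MvPowerSeries.one_le_order_iff_constCoeff_eq_zero]
      have : Ideal.span (Set.range (MvPowerSeries.X : ι → MvPowerSeries ι K)) ≤
          RingHom.ker (MvPowerSeries.constantCoeff (σ := ι) (R := K)) := by
        rw [Ideal.span_le]
        rintro _ ⟨i, rfl⟩
        exact MvPowerSeries.constantCoeff_X i
      exact this hh
    push_cast
    exact (add_le_add (ih hg) h1).trans MvPowerSeries.le_order_mul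

theorem mem_span_X_of_constantCoeff_eq_zero [Finite ι] {f : MvPolynomial ι K}
    (hf : MvPolynomial.constantCoeff f = 0) :
    (f : MvPowerSeries ι K) ∈
      Ideal.span (Set.range (MvPowerSeries.X : ι → MvPowerSeries ι K)) := by
  have h1 : f ∈ Ideal.span (Set.range (MvPolynomial.X : ι → MvPolynomial ι K)) := by
    rw [← pow_one (Ideal.span _)]
    refine (MvPolynomial.mem_pow_idealOfVars_iff' 1 f).2 fun m hm => ?_
    rw [(Finsupp.degree_eq_zero_iff m).1 (Nat.lt_one_iff.1 hm)]
    exact hf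
  have h2 := Ideal.mem_map_of_mem (MvPolynomial.coeToMvPowerSeries.ringHom (σ := ι) (R := K)) h1
  rw [Ideal.map_span, ← Set.range_comp] at h2
  have h3 : MvPolynomial.coeToMvPowerSeries.ringHom ∘ MvPolynomial.X =
      (MvPowerSeries.X : ι → MvPowerSeries ι K) := funext fun i => MvPolynomial.coe_X i
  rwa [h3] at h2

/-- A homomorphism to a polynomial ring that maps an ideal to the ideal of the origin extends to
the completions. -/
theorem exists_hom_adicCompletion [Finite ι] {A : Type*} [CommRing A] {I : Ideal A}
    (τ : A →+* MvPolynomial ι K) (hI : ∀ f ∈ I, MvPolynomial.constantCoeff (τ f) = 0) :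
    ∃ ψ : AdicCompletion I A →+* MvPowerSeries ι K,
      (∀ f, ψ (algebraMap A _ f) = (τ f : MvPowerSeries ι K)) ∧
        ∀ y m, ∃ f, MvPowerSeries.coeff m (ψ y) = (τ f).coeff m := by
  let J := Ideal.span (Set.range (MvPowerSeries.X : ι → MvPowerSeries ι K))
  let σ : A →+* MvPowerSeries ι K := MvPolynomial.coeToMvPowerSeries.ringHom.comp τ
  have hσ (n : ℕ) : I ^ n ≤ (J ^ n).comap σ := by
    refine le_trans (Ideal.pow_right_mono (fun f hf => ?_) n) (Ideal.le_comap_pow σ n)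
    exact mem_span_X_of_constantCoeff_eq_zero (hI f hf)
  let F (n : ℕ) : AdicCompletion I A →+* MvPowerSeries ι K ⧸ J ^ n :=
    (Ideal.quotientMap (J ^ n) σ (hσ n)).comp (AdicCompletion.evalₐ I n).toRingHom
  have hF {m n : ℕ} (hle : m ≤ n) : (Ideal.Quotient.factorPow J hle).comp (F n) = F m := by
    ext1 y
    obtain ⟨c, rfl⟩ := AdicCompletion.mk_surjective I A y
    change Ideal.Quotient.factorPow J hle (Ideal.quotientMap (J ^ n) σ (hσ n)
      (AdicCompletion.evalₐ I n (AdicCompletion.mk I A c))) = Ideal.quotientMap (J ^ m) σ (hσ m)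
      (AdicCompletion.evalₐ I m (AdicCompletion.mk I A c))
    have hc : Ideal.Quotient.mk (I ^ m) (c.val m) = Ideal.Quotient.mk (I ^ m) (c.val n) :=
      (AdicCompletion.Ideal.mk_eq_mk I hle c).symm
    rw [AdicCompletion.evalₐ_mk, AdicCompletion.evalₐ_mk, hc,
      Ideal.quotientMap_mk, Ideal.quotientMap_mk]
    rfl
  let ψ := IsAdicComplete.liftRingHom J F hF
  -- Coefficients of degree less than `n` depend only on the class modulo `Iⁿ`, so each coefficient
  -- of `ψ y` is that of some `τ f`. This keeps the support of `ψ y` inside the monoid.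
  have hψ (y f) (n : ℕ) (h : AdicCompletion.evalₐ I n y = Ideal.Quotient.mk _ f)
      {m : ι →₀ ℕ} (hm : m.degree < n) : MvPowerSeries.coeff m (ψ y) = (τ f).coeff m := by
    have h1 : Ideal.Quotient.mk (J ^ n) (ψ y) = Ideal.Quotient.mk (J ^ n) (σ f) := by
      rw [IsAdicComplete.mk_liftRingHom]
      change Ideal.quotientMap (J ^ n) σ (hσ n) (AdicCompletion.evalₐ I n y) = _
      rw [h, Ideal.quotientMap_mk]
    have h2 := le_order_of_mem_span_X_pow (Ideal.Quotient.eq.1 h1)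
    have h3 := MvPowerSeries.coeff_of_lt_order (f := ψ y - σ f) (d := m)
      (lt_of_lt_of_le (by exact_mod_cast hm) h2)
    rw [map_sub, sub_eq_zero] at h3
    rw [h3]
    exact MvPolynomial.coeff_coe _ _
  refine ⟨ψ, fun f => ?_, fun y m => ?_⟩
  · ext m
    exact (hψ _ f (m.degree + 1) (AdicCompletion.evalₐ_of I _ f) (Nat.lt_succ_self _)).trans
      (MvPolynomial.coeff_coe _ _).symm
  · obtain ⟨f, hf⟩ := Ideal.Quotient.mk_surjective (AdicCompletion.evalₐ I (m.degree + 1) y)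
    exact ⟨f, hψ y f _ hf.symm (Nat.lt_succ_self _)⟩

end Completion

/-! ### Monomial equations from finite quotient singularities -/

section FiniteQuotient

variable {K ι : Type*} [Field K]

/-- The completed local ring embeds by `φ` as the invariants of a finite group on a factorial power
series ring, and maps by `ψ` to the series in the coordinates of `V`. The prime `p` is pulled back
from `(X k)` along `ψ`; the norm argument gives an element of `p` dividing powers of all monomials
in `p`, and its image under `ψ` supplies the leading monomial. -/
theorem exists_mem_of_hasFiniteQuotientSingularities [Infinite K] [Finite ι] {A : Type*}
    [CommRing A] [Algebra K A] {M : AddSubmonoid (ι →₀ ℕ)}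
    (hsub : ∀ x ∈ M, ∀ y, x + y ∈ M → y ∈ M) {τ : A →+* MvPolynomial ι K}
    (hτ : Function.Injective τ) (hM : ∀ f m, (τ f).coeff m ≠ 0 → m ∈ M)
    (hmon : ∀ m : M, ∃ f, τ f = MvPolynomial.monomial m.1 1) {I : Ideal A} (hImax : I.IsMaximal)
    (hI : ∀ f ∈ I, MvPolynomial.constantCoeff (τ f) = 0)
    (hfin : HasFiniteQuotientSingularities K A) {k : ι} (harch : IsArchimedeanAt M k)
    (hne : ∃ m ∈ M, m k ≠ 0) :
    ∃ u ∈ M, u k ≠ 0 ∧ ∀ m ∈ M, m k ≠ 0 → ∃ N : ℕ, u ≤ N • m := by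
  obtain ⟨n, Γ, hΓ, ⟨e⟩⟩ := hfin I hImax
  have : UniqueFactorizationMonoid (MvPowerSeries (Fin n) K) :=
    uniqueFactorizationMonoid_mvPowerSeries n
  have : IsDomain (MvPowerSeries (Fin n) K) := NoZeroDivisors.to_isDomain _
  obtain ⟨ψ, hψ, hψM⟩ := exists_hom_adicCompletion τ hI
  choose y hy using hmon
  let x (m : M) : AdicCompletion I A := algebraMap A _ (y m)
  have hx (m : M) : ψ (x m) = MvPowerSeries.monomial m.1 1 := by
    rw [hψ, hy, MvPolynomial.coe_monomial]
  have hXk : Prime (MvPowerSeries.X k : MvPowerSeries ι K) := prime_X_mvPowerSeries K k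
  let p := (Ideal.span {(MvPowerSeries.X k : MvPowerSeries ι K)}).comap ψ
  have hp : p.IsPrime :=
    ((Ideal.span_singleton_prime hXk.ne_zero).2 hXk).comap ψ
  have hmem (y) : y ∈ p ↔ ∀ m, MvPowerSeries.coeff m (ψ y) ≠ 0 → m k ≠ 0 := by
    rw [Ideal.mem_comap, Ideal.mem_span_singleton, MvPowerSeries.X_dvd_iff]
    exact forall_congr' fun m => not_imp_not.symm
  have hxp (m : M) : x m ∈ p ↔ m.1 k ≠ 0 := by
    classical
    rw [hmem, hx]
    refine ⟨fun h => h _ (by rw [MvPowerSeries.coeff_monomial_same]; exact one_ne_zero),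
      fun h m' hm' => ?_⟩
    rw [MvPowerSeries.coeff_monomial] at hm'
    split_ifs at hm' with h1
    · rwa [h1]
    · exact absurd rfl hm'
  let φ : AdicCompletion I A →+* MvPowerSeries (Fin n) K :=
    (FixedPoints.subalgebra K (MvPowerSeries (Fin n) K) Γ).toSubring.subtype.comp
      (RingHomClass.toRingHom e)
  have hφ (y) : φ y = (e y).1 := rfl
  obtain ⟨g, hgp, hg⟩ := exists_mem_forall_dvd_pow_of_finite_group (G := Γ) φ
    (Subtype.val_injective.comp e.injective)
    (fun c => ⟨fun hc => ⟨e.symm ⟨c, hc⟩, by rw [hφ, AlgEquiv.apply_symm_apply]⟩, by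
      rintro ⟨y, rfl⟩ γ
      exact (e y).2 γ⟩) hp
    (X := x '' {m | m.1 k ≠ 0})
    (by rintro _ ⟨m, hm, rfl⟩; exact (hxp m).2 hm)
    (by
      rintro ⟨m, -, h0⟩
      have h1 := hx m
      rw [h0, map_zero] at h1
      have h2 := congrArg (MvPowerSeries.coeff m.1) h1
      rw [MvPowerSeries.coeff_monomial_same, map_zero] at h2
      exact zero_ne_one h2)
    (by
      rintro _ ⟨m, hm, rfl⟩ _ ⟨m', hm', rfl⟩
      obtain ⟨N, f, hf, hfk, hle⟩ := harch m m.2 m' m'.2 hm'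
      -- The archimedean property supplies the multiplier outside `p`: the monomial of `f`, which
      -- vanishes at `k`.
      refine ⟨x ⟨f, hf⟩, fun h => (hxp _).1 h hfk, N, ?_⟩
      obtain ⟨d, hd⟩ := exists_add_of_le hle
      have hdM : d ∈ M := hsub m.1 m.2 d (by
        rw [← hd]; exact add_mem hf (nsmul_mem m'.2 N))
      refine ⟨x ⟨d, hdM⟩, ?_⟩
      simp only [x, ← map_pow, ← map_mul]
      congr 1
      apply hτ
      simp only [map_pow, map_mul, hy, MvPolynomial.monomial_pow, MvPolynomial.monomial_mul,
        one_pow, mul_one, hd])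
  refine exists_mem_of_forall_dvd_monomial (K := K) (g := ψ g)
    (fun m hm => ⟨?_, (hmem g).1 hgp m hm⟩) (fun m hm hmk => ?_) hne
  · obtain ⟨f, hf⟩ := hψM g m
    rw [hf] at hm
    exact hM f m hm
  · obtain ⟨N, hN⟩ := hg _ ⟨⟨m, hm⟩, hmk, rfl⟩
    refine ⟨N, ?_⟩
    have h1 := map_dvd ψ hN
    rwa [map_pow, hx, MvPowerSeries.monomial_pow, one_pow] at h1

end FiniteQuotient

/-! ### Polynomial invariants and freeness from least elements -/

section MonoidAlgebra

variable {K ι : Type*} [Field K] {M : AddSubmonoid (ι →₀ ℕ)}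

/-- A ring of polynomials supported on a monoid with least elements is a polynomial ring. -/
theorem isRegularRing_of_isLeastAt [Finite ι] {A : Type*} [CommRing A] [Algebra K A]
    (hsub : ∀ x ∈ M, ∀ y, x + y ∈ M → y ∈ M) (hleast : ∀ k, ∃ c, IsLeastAt M k c)
    {τ : A →ₐ[K] MvPolynomial ι K} (hτ : Function.Injective τ)
    (hM : ∀ f m, (τ f).coeff m ≠ 0 → m ∈ M)
    (hmon : ∀ m : M, ∃ f, τ f = MvPolynomial.monomial m.1 1) : IsRegularRing A := by
  have hmrange := mrange_leastElementsHom hsub hleast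
  have hleM (c : leastElements M) : c.1 ∈ M := by obtain ⟨k, hk⟩ := c.2; exact hk.1
  choose y hy using hmon
  -- `Φ` embeds the polynomial ring on the least elements as the polynomials supported on `M`. It
  -- factors through `τ`, which makes `F` an isomorphism onto `A`.
  let Φ : MvPolynomial (leastElements M) K →ₐ[K] MvPolynomial ι K :=
    AddMonoidAlgebra.mapDomainAlgHom K K (leastElementsHom M)
  have hΦ (s : leastElements M →₀ ℕ) (c : K) :
      Φ (MvPolynomial.monomial s c) = MvPolynomial.monomial (leastElementsHom M s) c :=
    AddMonoidAlgebra.mapDomain_single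
  let F : MvPolynomial (leastElements M) K →ₐ[K] A :=
    MvPolynomial.aeval fun c => y ⟨c.1, hleM c⟩
  have hF : τ.comp F = Φ := by
    refine MvPolynomial.algHom_ext fun c => ?_
    rw [AlgHom.comp_apply, MvPolynomial.aeval_X, hy, MvPolynomial.X, hΦ, leastElementsHom_single,
      one_smul]
  have hFΦ (p) : τ (F p) = Φ p := DFunLike.congr_fun hF p
  have hinj : Function.Injective F := by
    have h1 : Function.Injective Φ :=
      AddMonoidAlgebra.mapDomain_injective (leastElementsHom_injective hsub)
    intro p q hpq
    apply h1
    rw [← hFΦ, ← hFΦ, hpq]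
  have hsurj : Function.Surjective F := by
    intro f
    suffices h : τ f ∈ Φ.range by
      obtain ⟨p, hp⟩ := h
      exact ⟨p, hτ ((hFΦ p).trans hp)⟩
    rw [(τ f).as_sum]
    refine sum_mem fun m hm => ?_
    have hmM := hM f m (MvPolynomial.mem_support_iff.1 hm)
    rw [← hmrange] at hmM
    obtain ⟨s, rfl⟩ := hmM
    exact ⟨MvPolynomial.monomial s _, hΦ s _⟩
  have : Finite (leastElements M) := finite_leastElements
  have : IsRegularRing (MvPolynomial (leastElements M) K) :=
    MvPolynomial.isRegularRing_of_isRegularRing K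
  exact IsRegularRing.of_ringEquiv (RingEquiv.ofBijective F ⟨hinj, hsurj⟩)

/-- A polynomial ring is free over the polynomials supported on a monoid with least elements. -/
theorem free_of_isLeastAt {A B : Type*} [CommRing A] [CommRing B] [Algebra A B] [Algebra K B]
    (hsub : ∀ x ∈ M, ∀ y, x + y ∈ M → y ∈ M) (hleast : ∀ k, ∃ c, IsLeastAt M k c)
    (e : MvPolynomial ι K ≃ₐ[K] B)
    (hM : ∀ (f : A) m, (e.symm (algebraMap A B f)).coeff m ≠ 0 → m ∈ M)
    (hmon : ∀ (m : M) (c : K), ∃ f : A, algebraMap A B f = e (MvPolynomial.monomial m.1 c))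
    (hinj : Function.Injective (algebraMap A B)) : Module.Free A B := by
  classical
  -- The basis consists of the monomials whose exponent has no nonzero element of `M` below it.
  let S := {b : ι →₀ ℕ // ∀ x ∈ M, x ≤ b → x = 0}
  let v (b : S) : B := e (MvPolynomial.monomial b.1 1)
  refine Module.Free.of_basis (Module.Basis.mk (v := v) ?_ ?_)
  · rw [linearIndependent_iff]
    intro l hl
    ext b
    apply hinj
    rw [Finsupp.zero_apply, map_zero, ← e.symm.map_eq_zero_iff]
    ext m
    rw [MvPolynomial.coeff_zero]
    by_contra hne
    have hmM := hM _ _ hne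
    have h1 := congrArg (fun z => (e.symm z).coeff (m + b.1)) hl
    simp only [Finsupp.linearCombination_apply, Finsupp.sum, map_sum, Algebra.smul_def, map_mul, v,
      AlgEquiv.symm_apply_apply, map_zero, MvPolynomial.coeff_zero, MvPolynomial.coeff_sum] at h1
    -- By uniqueness of the decomposition, the exponent `m + b` can only come from the basis element
    -- `b`.
    rw [Finset.sum_eq_single b, MvPolynomial.coeff_mul_monomial, mul_one] at h1
    · exact hne h1
    · intro b' _ hb'
      rw [MvPolynomial.coeff_mul_monomial', mul_one]
      split_ifs with hle
      · by_contra hne'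
        have h2 := eq_of_add_eq_add_of_isLeastAt hsub hleast (hM _ _ hne') hmM b'.2 b.2
          (tsub_add_cancel_of_le hle)
        rw [h2] at hne'
        have h3 := tsub_add_cancel_of_le hle
        rw [h2] at h3
        exact hb' (Subtype.ext (add_left_cancel h3))
      · rfl
    · intro hb
      rw [Finsupp.notMem_support_iff.1 hb, map_zero, map_zero, zero_mul, MvPolynomial.coeff_zero]
  · rintro z -
    obtain ⟨p, rfl⟩ := e.surjective z
    rw [p.as_sum, map_sum]
    refine sum_mem fun s _ => ?_
    obtain ⟨m, hm, b, hb, rfl⟩ := exists_eq_add_of_reduced M s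
    obtain ⟨f, hf⟩ := hmon ⟨m, hm⟩ (p.coeff (m + b))
    have h1 : e (MvPolynomial.monomial (m + b) (p.coeff (m + b))) = f • v ⟨b, hb⟩ := by
      rw [Algebra.smul_def, hf, ← map_mul, MvPolynomial.monomial_mul, mul_one]
    rw [h1]
    exact Submodule.smul_mem _ _ (Submodule.subset_span ⟨_, rfl⟩)

end MonoidAlgebra

/-! ### Assembling the four conclusions -/

section Main

variable {K V ι : Type*} [Field K] [IsAlgClosed K] [AddCommGroup V] [Module K V]
  [Fintype ι] {r : ℕ} {ρ : Representation K (Torus K r) V} {a : ι → Fin r → ℤ}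
  {b : Module.Basis ι K V} (hb : ∀ t i, ρ t (b i) = torusChar K (a i) t • b i)

include hb

theorem exists_mem_weightMonoid_ne_zero (hst : IsStable ρ) (k : ι) :
    ∃ m ∈ weightMonoid a, m k ≠ 0 := by
  obtain ⟨m, hm, h⟩ := isStableSupport_univ hb hst _ subset_rfl
  exact ⟨m, hm, (h k).2 (Set.mem_univ k)⟩

theorem mapsToDivisor_of_isTied (hst : IsStable ρ) (hn : IsNice ρ) {k : ι}
    (hk : IsTied (weightMonoid a) k) : MapsToDivisor ρ (coordSubspace b {k}) :=
  hn _ (isComponent_coordSubspace_singleton hb hst hk) (isDivisorial_coordSubspace_singleton b k)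

/-- Niceness turns every tied hyperplane into a prime divisor, hence every tied coordinate into an
archimedean one; this is the remaining input of `exists_isLeastAt`. -/
theorem exists_isLeastAt_of_isNice (hst : IsStable ρ) (hn : IsNice ρ) {k : ι}
    (hk : IsTied (weightMonoid a) k)
    (hu : ∃ u ∈ weightMonoid a, u k ≠ 0 ∧ ∀ m ∈ weightMonoid a, m k ≠ 0 → ∃ N : ℕ, u ≤ N • m) :
    ∃ c, IsLeastAt (weightMonoid a) k c ∧ ∀ i, c i ≠ 0 → IsTied (weightMonoid a) i := by
  have := IsAlgClosed.instInfinite (K := K)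
  obtain ⟨u, huM, huk, hu⟩ := hu
  exact exists_isLeastAt (weightMonoid_fg a) (weightMonoid_sub a) (weightMonoid_div a)
    (isStableSupport_univ hb hst) (fun i hi => isArchimedeanAt_of_mapsToDivisor hb
      (mapsToDivisor_of_isTied hb hst hn hi)) hk huM huk hu

theorem isPrincipal_of_isLeastAt {k : ι} (h : MapsToDivisor ρ (coordSubspace b {k}))
    {c : ι →₀ ℕ} (hc : IsLeastAt (weightMonoid a) k c) :
    EffectiveDivisor.IsPrincipal (imageDivisor h) := by
  have := IsAlgClosed.instInfinite (K := K)
  have h1 := (ideal_imageDivisor h).trans (imageIdeal_eq_span_of_isLeastAt hb hc)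
  exact ⟨⟨_, h1⟩⟩

theorem isCofree_of_isLeastAt (hleast : ∀ k, ∃ c, IsLeastAt (weightMonoid a) k c) :
    IsCofree ρ := by
  have := IsAlgClosed.instInfinite (K := K)
  have hM (f : invariants ρ) (m) (hm : ((polyEquiv b).symm
      (algebraMap (invariants ρ) (coordRing K V) f)).coeff m ≠ 0) : m ∈ weightMonoid a :=
    mem_weightMonoid_of_coeff_toPoly hb (f := f) hm
  have hmon (m : weightMonoid a) (c : K) : ∃ f : invariants ρ,
      algebraMap (invariants ρ) (coordRing K V) f =
        polyEquiv b (MvPolynomial.monomial m.1 c) := by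
    obtain ⟨f, hf⟩ := exists_toPoly_eq hb (p := MvPolynomial.monomial m.1 c) fun m' hm' => by
      classical
      rw [MvPolynomial.coeff_monomial] at hm'
      split_ifs at hm' with h
      · exact h ▸ m.2
      · exact absurd rfl hm'
    exact ⟨f, (polyEquiv_toPoly (b := b) f).symm.trans (congrArg (polyEquiv b) hf)⟩
  have hinj : Function.Injective (algebraMap (invariants ρ) (coordRing K V)) :=
    Subtype.val_injective
  have h := @free_of_isLeastAt K ι _ (weightMonoid a) (invariants ρ) (coordRing K V) _ _ _ _
    (weightMonoid_sub a) hleast (polyEquiv b)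
  exact h hM hmon hinj

theorem isRegularRing_invariants (hleast : ∀ k, ∃ c, IsLeastAt (weightMonoid a) k c) :
    IsRegularRing (invariants ρ) := by
  have := IsAlgClosed.instInfinite (K := K)
  have hM (f : invariants ρ) (m) (hm : (toPoly ρ b f).coeff m ≠ 0) : m ∈ weightMonoid a :=
    mem_weightMonoid_of_coeff_toPoly hb hm
  have hmon (m : weightMonoid a) : ∃ f, toPoly ρ b f = MvPolynomial.monomial m.1 1 :=
    ⟨_, toPoly_invMonomial hb m⟩
  have hinj : Function.Injective (toPoly ρ b) := toPoly_injective
  exact isRegularRing_of_isLeastAt (weightMonoid_sub a) hleast hinj hM hmon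

/-- The conclusions for npure representations, from equations of the divisors up to powers. -/
theorem isCNPure_isCofree_isRegularRing (hnp : IsNPure ρ)
    (hu : ∀ k, IsTied (weightMonoid a) k → MapsToDivisor ρ (coordSubspace b {k}) →
      ∃ u ∈ weightMonoid a, u k ≠ 0 ∧ ∀ m ∈ weightMonoid a, m k ≠ 0 → ∃ N : ℕ, u ≤ N • m) :
    (IsCNPure ρ ∧ IsCofree ρ) ∧ IsRegularRing (invariants ρ) := by
  have := IsAlgClosed.instInfinite (K := K)
  have hn : IsNice ρ := fun Z hZ _ => hnp.2 Z hZ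
  have hst := hnp.1.1
  have hleast : ∀ j, IsTied (weightMonoid a) j → ∃ c, IsLeastAt (weightMonoid a) j c ∧
      ∀ k, c k ≠ 0 → IsTied (weightMonoid a) k := fun k hk =>
    exists_isLeastAt_of_isNice hb hst hn hk (hu k hk (mapsToDivisor_of_isTied hb hst hn hk))
  have hall := exists_isLeastAt_of_forall_isTied (weightMonoid_sub a) (weightMonoid_div a)
    (isStableSupport_isTied_of_isPure hb hnp.1) hleast
  refine ⟨⟨⟨hnp, fun Z hZ => ?_⟩, ?_⟩, ?_⟩
  · obtain ⟨k, hk, rfl⟩ := exists_eq_coordSubspace_singleton_of_isComponent hb hst hZ (hnp.1.2 Z hZ)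
    obtain ⟨c, hc, -⟩ := hleast k hk
    exact ⟨hnp.2 _ hZ, isPrincipal_of_isLeastAt hb _ hc⟩
  · exact isCofree_of_isLeastAt hb hall
  · exact isRegularRing_invariants hb hall

theorem isRegularRing_of_hasFiniteQuotientSingularities (hnp : IsNPure ρ)
    (hfin : HasFiniteQuotientSingularities K (invariants ρ)) :
    (IsCNPure ρ ∧ IsCofree ρ) ∧ IsRegularRing (invariants ρ) := by
  have := IsAlgClosed.instInfinite (K := K)
  refine isCNPure_isCofree_isRegularRing hb hnp fun k _ hk => ?_
  have hM (f : invariants ρ) (m) (hm : (toPoly ρ b f).coeff m ≠ 0) : m ∈ weightMonoid a :=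
    mem_weightMonoid_of_coeff_toPoly hb hm
  have hmon (m : weightMonoid a) : ∃ f, toPoly ρ b f = MvPolynomial.monomial m.1 1 :=
    ⟨_, toPoly_invMonomial hb m⟩
  have hinj : Function.Injective (toPoly ρ b) := toPoly_injective
  have hmax : (originIdeal ρ b).IsMaximal := isMaximal_originIdeal
  have hI (f : invariants ρ) (hf : f ∈ originIdeal ρ b) :
      MvPolynomial.constantCoeff (toPoly ρ b f) = 0 := mem_originIdeal.1 hf
  exact exists_mem_of_hasFiniteQuotientSingularities (weightMonoid_sub a)
    (τ := (toPoly ρ b).toRingHom) hinj hM hmon hmax hI hfin (isArchimedeanAt_of_mapsToDivisor hb hk)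
    (exists_mem_weightMonoid_ne_zero hb hnp.1.1 k)

theorem isCNPure_isCofree_of_isQFactorial (hnp : IsNPure ρ) (hQ : IsQFactorial (invariants ρ)) :
    IsCNPure ρ ∧ IsCofree ρ := by
  have := IsAlgClosed.instInfinite (K := K)
  exact (isCNPure_isCofree_isRegularRing hb hnp fun k _ hk => exists_mem_of_isQCartier hb hk
    (hQ.2 _) (exists_mem_weightMonoid_ne_zero hb hnp.1.1 k)).1

/-- A least element at the tied coordinate makes the divisor even principal. Purity is not needed,
because untied coordinates play no role. -/
theorem isQCartier_iff_isCartier (hst : IsStable ρ) (hn : IsNice ρ) {Z : Set V}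
    (hZ : IsComponent K V (sssLocus ρ) Z) (hdiv : IsDivisorial K V Z) (h : MapsToDivisor ρ Z) :
    EffectiveDivisor.IsQCartier (imageDivisor h) ↔ EffectiveDivisor.IsCartier (imageDivisor h) := by
  have := IsAlgClosed.instInfinite (K := K)
  refine ⟨fun hQ => ?_, isQCartier_of_isCartier⟩
  obtain ⟨k, hk, rfl⟩ := exists_eq_coordSubspace_singleton_of_isComponent hb hst hZ hdiv
  obtain ⟨c, hc, -⟩ := exists_isLeastAt_of_isNice hb hst hn hk
    (exists_mem_of_isQCartier hb h hQ (exists_mem_weightMonoid_ne_zero hb hst k))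
  exact isCartier_of_isPrincipal (isPrincipal_of_isLeastAt hb h hc)

end Main

end

end TorusQuotient

theorem mainTheorem9 {K : Type*} [Field K] [IsAlgClosed K] [CharZero K]
    {V : Type*} [AddCommGroup V] [Module K V] [FiniteDimensional K V] {r : ℕ}
    (ρ : Representation K (TorusQuotient.Torus K r) V) (hρ : TorusQuotient.IsAlgebraic ρ) :
    -- a singular quotient of an npure representation has worse than finite quotient singularities
    (TorusQuotient.IsNPure ρ → ¬ IsRegularRing (TorusQuotient.invariants ρ) →
      ¬ TorusQuotient.HasFiniteQuotientSingularities K (TorusQuotient.invariants ρ)) ∧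
    -- npure with finite quotient singularities implies cnpure and cofree
    (TorusQuotient.IsNPure ρ →
      TorusQuotient.HasFiniteQuotientSingularities K (TorusQuotient.invariants ρ) →
      TorusQuotient.IsCNPure ρ ∧ TorusQuotient.IsCofree ρ) ∧
    -- npure with `ℚ`-factorial quotient implies cnpure and cofree
    (TorusQuotient.IsNPure ρ → TorusQuotient.IsQFactorial (TorusQuotient.invariants ρ) →
      TorusQuotient.IsCNPure ρ ∧ TorusQuotient.IsCofree ρ) ∧
    -- the image of a divisorial component of `V^sss` is `ℚ`-Cartier if and only if it is Cartier
    (TorusQuotient.IsStable ρ → TorusQuotient.IsNice ρ →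
      ∀ Z : Set V, TorusQuotient.IsComponent K V (TorusQuotient.sssLocus ρ) Z →
        TorusQuotient.IsDivisorial K V Z →
        ∃ h : TorusQuotient.MapsToDivisor ρ Z,
          (TorusQuotient.EffectiveDivisor.IsQCartier (TorusQuotient.imageDivisor h) ↔
            TorusQuotient.EffectiveDivisor.IsCartier (TorusQuotient.imageDivisor h))) := by
  obtain ⟨n, b, a, hb⟩ := TorusQuotient.exists_weightBasis ρ hρ
  exact ⟨fun hnp hsing hfin =>
      hsing (TorusQuotient.isRegularRing_of_hasFiniteQuotientSingularities hb hnp hfin).2,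
    fun hnp hfin => (TorusQuotient.isRegularRing_of_hasFiniteQuotientSingularities hb hnp hfin).1,
    TorusQuotient.isCNPure_isCofree_of_isQFactorial hb,
    fun hst hn Z hZ hdiv =>
      ⟨hn Z hZ hdiv, TorusQuotient.isQCartier_iff_isCartier hb hst hn hZ hdiv _⟩⟩
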